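/- Setting. Let $\Omega\subset\mathbb{R}^d$ be open, let $(Z,\nu)$ be a $\sigma$-finite measure space (for instance $\mathbb{R}^m$ with Lebesgue measure), and let $q(z|\lambda)>0$, $\lambda\in\Omega$, be a jointly measurable family of probability densities with respect to $\nu$ such that, for each $z$, the function $q(z|\cdot)$ is $C^1$ on $\Omega$ and bounded there together with its gradient. Let $f:Z\to\mathbb{R}$ be measurable. For a finite measure $\rho$ on $\Omega$ put $q_\rho(z)=\int q(z|\lambda)\,d\rho(\lambda)$ and $$\mathcal{L}(\rho)=\mathbb{E}_{\lambda\sim\rho}\,\mathbb{E}_{z\sim q(\cdot|\lambda)}\big[f(z)+\log q_\rho(z)\big].$$ A function $\delta\mathcal{L}(\rho)$ is a first variation of $\mathcal{L}$ at $\rho$ if it is $\chi$-integrable and $\lim_{\varepsilon\downarrow0}\frac1\varepsilon\big(\mathcal{L}(\rho+\varepsilon\chi)-\mathcal{L}(\rho)\big)=\int\delta\mathcal{L}(\rho)\,d\chi$ for every compactly supported probability distribution $\chi$ on $\Omega$. Let $C(\lambda)\in\mathbb{R}^{d\times d}$ be symmetric positive definite for $\lambda\in\Omega$ and measurable in $\lambda$.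 Flow. Let $T>0$, let $(\rho_t)_{t\in[0,T]}$ be probability distributions on $\Omega$, let $\delta\mathcal{L}(\rho_t)$ be a first variation of $\mathcal{L}$ at $\rho_t$, and put $v_t=-\nabla\delta\mathcal{L}(\rho_t)$. Suppose that $\partial_t\rho_t+\mathrm{div}(\rho_t\,C v_t)=0$ on $[0,T]$ in the weak sense without flux through $\partial\Omega$: for every $t\in[0,T]$ and every $C^1$ function $\varphi$ on $\Omega$ that is bounded, has bounded gradient, and vanishes outside a bounded set, $\frac{d}{dt}\int\varphi\,d\rho_t=\int\langle\nabla\varphi,Cv_t\rangle\,d\rho_t$ (one-sided at $t=0,T$). For $\Omega=\mathbb{R}^d$ these $\varphi$ are exactly the compactly supported $C^1$ functions. Integrability. Suppose that $\sup_{t\in[0,T]}\|Cv_t\|_{L^2(\rho_t)}<\infty$ and that there are functions $\ell,G\ge0$ on $Z$ such that: for $\nu$-almost every $z$ and all $t\in[0,T]$, $|\log q_{\rho_t}(z)|\le\ell(z)$ and $\int\|\nabla_\lambda q(z|\lambda)\|^2d\rho_t(\lambda)\le G(z)^2$; the functions $G\,(1+|f|+\ell)$ and $q_{\rho_0}\,(|f|+\ell)$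 are $\nu$-integrable; for each $\lambda\in\Omega$, the functions $q(\cdot|\lambda)(|f|+\ell)$ and $q(\cdot|\lambda)\log q(\cdot|\lambda)$ are $\nu$-integrable; and each $\lambda_0\in\Omega$ has a neighbourhood $U$ and a function $H$ with $\|\nabla_\lambda q(z|\lambda)\|\le H(z)$ for all $\lambda\in U$ and $\nu$-almost every $z$, and $H\,(1+|f|+\ell)$ $\nu$-integrable. Conclusion. For every $t\in[0,T]$, the integrand of $\mathcal{L}(\rho_t)$ is integrable with respect to $\rho_t\otimes\nu$, $\delta\mathcal{L}(\rho_t)$ is differentiable on $\Omega$, $\langle v_t,Cv_t\rangle$ is $\rho_t$-integrable, and $t\mapsto\mathcal{L}(\rho_t)$ is differentiable at $t$ (one-sided at $0$ and $T$) with $$\frac{d\mathcal{L}(\rho_t)}{dt}=-\langle v_t,Cv_t\rangle_{L^2(\rho_t)}=-\int\langle v_t(\lambda),C(\lambda)v_t(\lambda)\rangle\,d\rho_t(\lambda)\le0 .$$ Consequently $\mathcal{L}$ is non-increasing along the flow: $\mathcal{L}(\rho_t)\le\mathcal{L}(\rho_s)$ for $0\le s\le t\le T$. -/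

import Mathlib

open MeasureTheory Set Filter Topology
open scoped ENNReal NNReal ContDiff

namespace VarFlow

/-- The parameter space `ℝ^d` with its Euclidean structure. -/
abbrev Vec (d : ℕ) : Type := EuclideanSpace ℝ (Fin d)

noncomputable section

/-- The mixture density `q_ρ(z) = ∫ q(z|x) dρ(x)`; the density `q(z|x)` is written `q x z`. -/
def mixture {d : ℕ} {Z : Type*} (q : Vec d → Z → ℝ) (ρ : Measure (Vec d)) (z : Z) : ℝ :=
  ∫ x, q x z ∂ρ

/-- The negated ELBO as a functional of the mixing measure,
`𝓛(ρ) = E_{x ∼ ρ} E_{z ∼ q(·|x)} [f(z) + log q_ρ(z)]`. -/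
def negELBO {d : ℕ} {Z : Type*} [MeasurableSpace Z] (ν : Measure Z) (q : Vec d → Z → ℝ)
    (f : Z → ℝ) (ρ : Measure (Vec d)) : ℝ :=
  ∫ x, ∫ z, q x z * (f z + Real.log (mixture q ρ z)) ∂ν ∂ρ

/-- `g` is a first variation of the functional `F` at `ρ`, on the parameter domain `Ω`:
`lim_{ε ↓ 0} (F(ρ + ε χ) - F(ρ)) / ε = ∫ g dχ` for every compactly supported probability
distribution `χ` on `Ω`. -/
def IsFirstVariation {d : ℕ} (F : Measure (Vec d) → ℝ) (Ω : Set (Vec d))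
    (ρ : Measure (Vec d)) (g : Vec d → ℝ) : Prop :=
  ∀ χ : Measure (Vec d), IsProbabilityMeasure χ →
    (∃ K : Set (Vec d), IsCompact K ∧ K ⊆ Ω ∧ χ Kᶜ = 0) →
      Integrable g χ ∧
      Tendsto (fun ε : ℝ => (F (ρ + ENNReal.ofReal ε • χ) - F ρ) / ε) (𝓝[>] 0) (𝓝 (∫ x, g x ∂χ))

/-- Test functions on the open set `Ω` for the no-flux problem: of class `C¹` on `Ω`, bounded with
bounded gradient, and with bounded support. They need not vanish at the boundary of `Ω`.
For `Ω = ℝ^d` these are exactly the `C¹` functions with compact support. -/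
structure IsTestFunction {d : ℕ} (Ω : Set (Vec d)) (φ : Vec d → ℝ) : Prop where
  contDiffOn : ContDiffOn ℝ 1 φ Ω
  bounded : ∃ M : ℝ, ∀ x ∈ Ω, |φ x| ≤ M ∧ ‖gradient φ x‖ ≤ M
  bounded_support : Bornology.IsBounded (Ω ∩ Function.support φ)

/-- The continuity equation `∂ₜ ρ_t + div(ρ_t w_t) = 0` on `Ω` for `t ∈ [0, T]`, in the weak sense
with no flux through the boundary: for every test function `φ` and every `t`,
`d/dt ∫ φ dρ_t = ∫ ⟨∇φ, w_t⟩ dρ_t` (one-sided derivatives at `0` and `T`). -/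
def SolvesContinuityEq {d : ℕ} (Ω : Set (Vec d)) (T : ℝ) (ρ : ℝ → Measure (Vec d))
    (w : ℝ → Vec d → Vec d) : Prop :=
  ∀ φ : Vec d → ℝ, IsTestFunction Ω φ → ∀ t ∈ Icc 0 T,
    HasDerivWithinAt (fun s => ∫ x, φ x ∂(ρ s))
      (∫ x, inner ℝ (gradient φ x) (w t x) ∂(ρ t)) (Icc 0 T) t

/-- The velocity field `v = -∇g`. -/
def velocity {d : ℕ} (g : Vec d → ℝ) (x : Vec d) : Vec d := -gradient g x

/-- The preconditioned field `x ↦ C(x) v(x)`. -/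
def precond {d : ℕ} (C : Vec d → Matrix (Fin d) (Fin d) ℝ) (v : Vec d → Vec d) (x : Vec d) :
    Vec d :=
  Matrix.toEuclideanLin (C x) (v x)

/-- `(ρ_t)`, `t ∈ [0, T]`, is a preconditioned Wasserstein gradient flow of `F` in `𝒫(Ω)`:
`∂ₜ ρ_t + div(ρ_t C v_t) = 0` with `v_t = -∇ δF(ρ_t)`, where `g t = δF(ρ_t)`. -/
structure IsGradientFlow {d : ℕ} (F : Measure (Vec d) → ℝ) (Ω : Set (Vec d))
    (C : Vec d → Matrix (Fin d) (Fin d) ℝ) (T : ℝ) (ρ : ℝ → Measure (Vec d))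
    (g : ℝ → Vec d → ℝ) : Prop where
  isProbabilityMeasure : ∀ t ∈ Icc 0 T, IsProbabilityMeasure (ρ t)
  carried : ∀ t ∈ Icc 0 T, ρ t Ωᶜ = 0
  firstVariation : ∀ t ∈ Icc 0 T, IsFirstVariation F Ω (ρ t) (g t)
  continuityEq : SolvesContinuityEq Ω T ρ (fun t => precond C (velocity (g t)))

/-- `q x`, `x ∈ Ω`, is a family of positive probability densities with respect to `ν`, which is
`C¹` in the parameter, with `q(z|·)` and `∇q(z|·)` bounded on `Ω` for each fixed `z`. -/
structure IsDensityFamily {d : ℕ} {Z : Type*} [MeasurableSpace Z] (ν : Measure Z)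
    (Ω : Set (Vec d)) (q : Vec d → Z → ℝ) : Prop where
  measurable : Measurable (Function.uncurry q)
  pos : ∀ x ∈ Ω, ∀ z, 0 < q x z
  integral_eq_one : ∀ x ∈ Ω, ∫ z, q x z ∂ν = 1
  contDiffOn : ∀ z, ContDiffOn ℝ 1 (fun x => q x z) Ω
  bounded : ∀ z, ∃ M : ℝ, ∀ x ∈ Ω, q x z ≤ M ∧ ‖gradient (fun y => q y z) x‖ ≤ M

/-- Integrability of the model at the single parameters `x ∈ Ω`, with respect to a weight `ℓ`:
`f`, `ℓ` and `log q(·|x)` have finite expectation under `q(·|x)`, and `∇q(z|·)` is dominated near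
`x` by a function that is integrable against `1 + |f| + ℓ`. -/
structure IsIntegrableModel {d : ℕ} {Z : Type*} [MeasurableSpace Z] (ν : Measure Z)
    (Ω : Set (Vec d)) (q : Vec d → Z → ℝ) (f ℓ : Z → ℝ) : Prop where
  expectation : ∀ x ∈ Ω, Integrable (fun z => q x z * (|f z| + ℓ z)) ν
  entropy : ∀ x ∈ Ω, Integrable (fun z => q x z * Real.log (q x z)) ν
  gradient_dominated : ∀ x ∈ Ω, ∃ U ∈ 𝓝 x, ∃ H : Z → ℝ,
    (∀ᵐ z ∂ν, ∀ y ∈ U, ‖gradient (fun y' => q y' z) y‖ ≤ H z) ∧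
    Integrable (fun z => H z * (1 + |f z| + ℓ z)) ν

/-- Integrability along the curve `(ρ_t)`, `t ∈ [0, T]`: `ℓ` dominates `|log q_{ρ_t}|`, the
function `G` dominates the `L²(ρ_t)` norm of `∇q(z|·)`, `f` and `ℓ` have finite expectation under
the initial mixture, and `G` is integrable against `1 + |f| + ℓ`. -/
structure IsIntegrableCurve {d : ℕ} {Z : Type*} [MeasurableSpace Z] (ν : Measure Z)
    (q : Vec d → Z → ℝ) (f ℓ G : Z → ℝ) (T : ℝ) (ρ : ℝ → Measure (Vec d)) : Prop where
  log_le : ∀ᵐ z ∂ν, ∀ t ∈ Icc 0 T, |Real.log (mixture q (ρ t) z)| ≤ ℓ z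
  G_nonneg : ∀ z, 0 ≤ G z
  gradient_le : ∀ᵐ z ∂ν, ∀ t ∈ Icc 0 T,
    ∫ x, ‖gradient (fun y => q y z) x‖ ^ 2 ∂(ρ t) ≤ G z ^ 2
  initial : Integrable (fun z => mixture q (ρ 0) z * (|f z| + ℓ z)) ν
  integrable_G : Integrable (fun z => G z * (1 + |f z| + ℓ z)) ν

end

end VarFlow

/-! Exchanging the two integrals turns the functional into `∫ r_t (f + log r_t) dν` with `r_t(z) =
q_{ρ_t}(z)`. For fixed `z`, `r_t(z)` is the integral of `φ = q(z|·)` against `ρ_t`, so the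
continuity equation gives `∂ₜ r_t(z) = ∫ ⟨∇q(z|·), C v_t⟩ dρ_t`. Since the derivative of `r (f + log
r)` in `r` is `ψ = f + log r + 1`, the functional has time derivative `∫ ψ_t ∂ₜ r_t dν`. A second
exchange of integrals makes this `∫ ⟨∫ ψ_t ∇q dν, C v_t⟩ dρ_t`, and the inner integral is `∇δ𝓛(ρ_t)
= -v_t`.

Three points need work. First, `q(z|·)` is bounded and `C¹` but need not have bounded support, so it
is not a test function: `IsBoundedFlow.hasDerivWithinAt_integral` extends the continuity equation to
such functions, using cutoffs and a tightness estimate along the flow. Second, the first variation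
is given only abstractly: testing it on Dirac masses, `IsDensityFamily.eq_of_isFirstVariation`
identifies it on `Ω` as `∫ q(z|x) ψ_t(z) dν`, and `IsDensityFamily.hasGradientAt_integral_mul`
differentiates this. Third, derivatives and integrals are interchanged by
`IsBoundedFlow.hasDerivWithinAt_negELBO` and `IsDensityFamily.integral_integral_inner_gradient`,
both with the majorant `B G (1 + |f| + ℓ)` supplied by Cauchy–Schwarz. -/

namespace VarFlow

/-! ### Analytic preliminaries: Cauchy–Schwarz, cutoffs, measurability of gradients, differentiation
under the integral -/

/-- Cauchy–Schwarz without measurability of `w`: factor `|h| = |u| · (|h| / |u|)`. The quotient is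
measurable because `h` and `u` are, and it is dominated by `‖w‖`, so only monotonicity of the upper
integral is applied to `w`. -/
lemma integrable_and_integral_abs_le_of_eLpNorm_two_le {X E : Type*} [MeasurableSpace X]
    [NormedAddCommGroup E] {μ : Measure X} {w : X → E} {B : ℝ≥0} (hw : eLpNorm w 2 μ ≤ B)
    {u h : X → ℝ} (hu : AEStronglyMeasurable u μ) (hu2 : Integrable (fun x => u x ^ 2) μ)
    {K : ℝ} (hK : 0 ≤ K) (huK : ∫ x, u x ^ 2 ∂μ ≤ K ^ 2) (hh : AEStronglyMeasurable h μ)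
    (hle : ∀ᵐ x ∂μ, |h x| ≤ u x * ‖w x‖) :
    Integrable h μ ∧ ∫ x, |h x| ∂μ ≤ K * B := by
  have hle' : ∀ᵐ x ∂μ, ‖h x‖ₑ ≤ ‖w x‖ₑ * ‖u x‖ₑ := by
    filter_upwards [hle] with x hx
    rw [← enorm_norm (w x), ← enorm_mul, enorm_le_iff_norm_le]
    rw [Real.norm_eq_abs, Real.norm_eq_abs, mul_comm]
    exact hx.trans (le_abs_self _)
  have key : ∫⁻ x, ‖h x‖ₑ ∂μ ≤ ENNReal.ofReal (K * B) := by
    calc ∫⁻ x, ‖h x‖ₑ ∂μ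
        = ∫⁻ x, ((fun x => ‖u x‖ₑ) * fun x => ‖h x‖ₑ / ‖u x‖ₑ) x ∂μ := by
          refine lintegral_congr_ae ?_
          filter_upwards [hle'] with x hx
          rcases eq_or_ne ‖u x‖ₑ 0 with h0 | h0
          · simp only [h0, mul_zero, nonpos_iff_eq_zero] at hx
            simp [hx]
          · simp only [Pi.mul_apply]
            rw [ENNReal.mul_div_cancel h0 enorm_ne_top]
      _ ≤ (∫⁻ x, ‖u x‖ₑ ^ (2 : ℝ) ∂μ) ^ (1 / (2 : ℝ)) *
          (∫⁻ x, (‖h x‖ₑ / ‖u x‖ₑ) ^ (2 : ℝ) ∂μ) ^ (1 / (2 : ℝ)) :=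
          ENNReal.lintegral_mul_le_Lp_mul_Lq μ Real.HolderConjugate.two_two hu.enorm
            (hh.enorm.div hu.enorm)
      _ ≤ ENNReal.ofReal K * B := by
          gcongr
          · have h1 : ∫⁻ x, ‖u x‖ₑ ^ (2 : ℝ) ∂μ = ENNReal.ofReal (∫ x, u x ^ 2 ∂μ) := by
              rw [ofReal_integral_eq_lintegral_ofReal hu2
                (Eventually.of_forall fun x => sq_nonneg _)]
              refine lintegral_congr fun x => ?_
              rw [Real.enorm_eq_ofReal_abs, ENNReal.ofReal_rpow_of_nonneg (abs_nonneg _) (by simp)]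
              simp
            rw [h1]
            calc _ ≤ (ENNReal.ofReal (K ^ 2)) ^ (1 / (2 : ℝ)) := by gcongr
              _ = ENNReal.ofReal K := by
                rw [ENNReal.ofReal_rpow_of_nonneg (by positivity) (by simp), ← Real.sqrt_eq_rpow,
                  Real.sqrt_sq hK]
          · refine le_trans ?_ hw
            rw [eLpNorm_eq_lintegral_rpow_enorm_toReal (by simp) (by simp)]
            simp only [ENNReal.toReal_ofNat]
            refine ENNReal.rpow_le_rpow (lintegral_mono_ae ?_) (by simp)
            filter_upwards [hle'] with x hx
            exact ENNReal.rpow_le_rpow (ENNReal.div_le_of_le_mul hx) (by simp)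
      _ = ENNReal.ofReal (K * B) := by
          rw [ENNReal.ofReal_mul hK, ENNReal.ofReal_coe_nnreal]
  have hi : Integrable h μ := ⟨hh, key.trans_lt ENNReal.ofReal_lt_top⟩
  refine ⟨hi, ?_⟩
  have := integral_norm_eq_lintegral_enorm hh
  simp only [Real.norm_eq_abs] at this
  rw [this]
  exact ENNReal.toReal_le_of_le_ofReal (by positivity) key

lemma tendsto_div_natCast_add_one (c : ℝ) :
    Tendsto (fun n : ℕ => c / ((n : ℝ) + 1)) atTop (𝓝 0) := by
  simpa [div_eq_mul_inv] using (tendsto_one_div_add_atTop_nhds_zero_nat (𝕜 := ℝ)).const_mul c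

/-- Dilations of one bump function by the factor `n + 1`. The gradients decay uniformly in `x`, so
cutting off costs little in the continuity equation. -/
lemma exists_cutoff (d : ℕ) : ∃ c : ℝ, 0 ≤ c ∧ ∃ χ : ℕ → Vec d → ℝ,
    (∀ n, ContDiff ℝ 1 (χ n)) ∧ (∀ n x, χ n x ∈ Icc (0 : ℝ) 1) ∧
    (∀ n, Bornology.IsBounded (Function.support (χ n))) ∧
    (∀ n x, ‖gradient (χ n) x‖ ≤ c / (n + 1)) ∧ ∀ x, ∀ᶠ n in atTop, χ n x = 1 := by
  let b : ContDiffBump (0 : Vec d) := ⟨1, 2, one_pos, one_lt_two⟩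
  have hb : ContDiff ℝ 1 (b : Vec d → ℝ) := b.contDiff
  obtain ⟨c, hc⟩ := (b.hasCompactSupport.fderiv ℝ).exists_bound_of_continuous
    (hb.continuous_fderiv one_ne_zero)
  have hn0 : ∀ n : ℕ, (0 : ℝ) < (n : ℝ) + 1 := fun n => by positivity
  have hs : ∀ n : ℕ, ContDiff ℝ 1 (fun x : Vec d => ((n : ℝ) + 1)⁻¹ • x) :=
    fun n => contDiff_const_smul _
  refine ⟨c, (norm_nonneg _).trans (hc 0), fun n x => b (((n : ℝ) + 1)⁻¹ • x),
    fun n => hb.comp (hs n), fun n x => ⟨b.nonneg, b.le_one⟩, fun n => ?_, fun n x => ?_, fun x => ?_⟩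
  · refine (Metric.isBounded_ball (x := (0 : Vec d)) (r := 2 * (n + 1))).subset fun x hx => ?_
    have hx' : ((n : ℝ) + 1)⁻¹ • x ∈ Function.support b := hx
    rw [b.support_eq, mem_ball_zero_iff, norm_smul, norm_inv, Real.norm_of_nonneg (hn0 n).le,
      inv_mul_lt_iff₀ (hn0 n)] at hx'
    rw [mem_ball_zero_iff]
    have : b.rOut = 2 := rfl
    rw [this] at hx'
    linarith
  · have h1 : ‖gradient (fun x => b (((n : ℝ) + 1)⁻¹ • x)) x‖
        = ‖fderiv ℝ (fun x => b (((n : ℝ) + 1)⁻¹ • x)) x‖ := by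
      rw [← toDual_gradient, LinearIsometryEquiv.norm_map]
    rw [h1, fderiv_comp_smul, norm_smul, norm_inv, Real.norm_of_nonneg (hn0 n).le, div_eq_inv_mul]
    exact mul_le_mul_of_nonneg_left (hc _) (inv_nonneg.2 (hn0 n).le)
  · obtain ⟨N, hN⟩ := exists_nat_ge ‖x‖
    filter_upwards [eventually_ge_atTop N] with n hn
    refine b.one_of_mem_closedBall ?_
    rw [mem_closedBall_zero_iff, norm_smul, norm_inv, Real.norm_of_nonneg (hn0 n).le,
      inv_mul_le_iff₀ (hn0 n)]
    have h3 : (N : ℝ) ≤ n := by exact_mod_cast hn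
    show ‖x‖ ≤ ((n : ℝ) + 1) * 1
    linarith

/-- Each coordinate is a pointwise limit of difference quotients with step `1/n`, which are jointly
measurable. The indicator discards the points outside `Ω`, where differentiability may fail. -/
lemma measurable_indicator_gradient {d : ℕ} {Z : Type*} [MeasurableSpace Z] {Ω : Set (Vec d)}
    (hΩ : IsOpen Ω) {q : Vec d → Z → ℝ} (hq : Measurable (Function.uncurry q))
    (hd : ∀ z, ∀ x ∈ Ω, DifferentiableAt ℝ (fun y => q y z) x) :
    Measurable ((Ω ×ˢ (univ : Set Z)).indicator
      fun p : Vec d × Z => gradient (fun y => q y p.2) p.1) := by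
  have hS : MeasurableSet (Ω ×ˢ (univ : Set Z)) := hΩ.measurableSet.prod MeasurableSet.univ
  refine (WithLp.measurable_toLp 2 (Fin d → ℝ)).comp
    (measurable_pi_iff.2 fun i => ?_) (g := WithLp.toLp 2)
    (f := fun p => WithLp.ofLp ((Ω ×ˢ (univ : Set Z)).indicator
      (fun p : Vec d × Z => gradient (fun y => q y p.2) p.1) p))
  let e : Vec d := EuclideanSpace.single i (1 : ℝ)
  refine measurable_of_tendsto_metrizable (f := fun (n : ℕ) => (Ω ×ˢ (univ : Set Z)).indicator
    fun p : Vec d × Z => ((n : ℝ) * (q (p.1 + (n : ℝ)⁻¹ • e) p.2 - q p.1 p.2)))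
    (fun n => ?_) (tendsto_pi_nhds.2 fun p => ?_)
  · refine Measurable.indicator (Measurable.const_mul (Measurable.sub ?_ hq) _) hS
    exact hq.comp (f := fun p : Vec d × Z => (p.1 + (n : ℝ)⁻¹ • e, p.2)) (by fun_prop)
  · by_cases hp : p ∈ Ω ×ˢ (univ : Set Z)
    · simp only [indicator_of_mem hp]
      have h1 := (hd p.2 p.1 hp.1).hasFDerivAt.lim e (c := fun n : ℕ => (n : ℝ)) (l := atTop)
        (by simpa using tendsto_natCast_atTop_atTop (R := ℝ))
      have h2 : (gradient (fun y => q y p.2) p.1).ofLp i = fderiv ℝ (fun y => q y p.2) p.1 e := by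
        rw [← inner_gradient_left]
        rw [EuclideanSpace.inner_single_right, one_mul]
        simp only [conj_trivial]
      rw [h2]
      exact h1
    · simp [indicator_of_notMem hp]

/-- Dominated convergence for the slopes, which the mean value inequality on the convex set `S`
bounds by `bound`. Working within `S` covers the one-sided derivatives at the endpoints. -/
lemma hasDerivWithinAt_integral_of_dominated {Z : Type*} [MeasurableSpace Z] {ν : Measure Z}
    {S : Set ℝ} (hS : Convex ℝ S) {F F' : ℝ → Z → ℝ} {bound : Z → ℝ} {t : ℝ} (ht : t ∈ S)
    (hF : ∀ s ∈ S, Integrable (F s) ν) (hbound : Integrable bound ν)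
    (hderiv : ∀ᵐ z ∂ν, ∀ s ∈ S, HasDerivWithinAt (fun r => F r z) (F' s z) S s)
    (hle : ∀ᵐ z ∂ν, ∀ s ∈ S, |F' s z| ≤ bound z) :
    HasDerivWithinAt (fun s => ∫ z, F s z ∂ν) (∫ z, F' t z ∂ν) S t := by
  rw [hasDerivWithinAt_iff_tendsto_slope]
  have hmem : ∀ᶠ s in 𝓝[S \ {t}] t, s ∈ S \ {t} := self_mem_nhdsWithin
  have h1 : Tendsto (fun s => ∫ z, slope (fun r => F r z) t s ∂ν) (𝓝[S \ {t}] t)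
      (𝓝 (∫ z, F' t z ∂ν)) := by
    refine tendsto_integral_filter_of_dominated_convergence bound ?_ ?_ hbound ?_
    · filter_upwards [hmem] with s hs
      simp only [slope_def_field]
      exact (((hF s hs.1).sub (hF t ht)).div_const _).aestronglyMeasurable
    · filter_upwards [hmem] with s hs
      filter_upwards [hderiv, hle] with z hz hz'
      have := hS.norm_image_sub_le_of_norm_hasDerivWithin_le (f := fun r => F r z) hz hz' ht hs.1
      rw [slope_def_field, norm_div]
      refine div_le_of_le_mul₀ (norm_nonneg _) ?_ this
      exact (abs_nonneg _).trans (hz' t ht)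
    · filter_upwards [hderiv] with z hz
      exact hasDerivWithinAt_iff_tendsto_slope.1 (hz t ht)
  refine h1.congr' ?_
  filter_upwards [hmem] with s hs
  simp only [slope_def_field]
  rw [integral_div, integral_sub (hF s hs.1) (hF t ht)]

/-! ### Bounded `C¹` functions and their products with cutoffs -/

/-- Functions of class `C¹` on `Ω`, bounded there together with their gradient. -/
structure IsBoundedC1 {d : ℕ} (Ω : Set (Vec d)) (φ : Vec d → ℝ) (M : ℝ) : Prop where
  contDiffOn : ContDiffOn ℝ 1 φ Ω
  abs_le : ∀ x ∈ Ω, |φ x| ≤ M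
  norm_gradient_le : ∀ x ∈ Ω, ‖gradient φ x‖ ≤ M

lemma ae_mem_of_measure_compl {d : ℕ} {Ω : Set (Vec d)} {μ : Measure (Vec d)}
    (hμ : μ Ωᶜ = 0) : ∀ᵐ x ∂μ, x ∈ Ω := hμ

lemma aestronglyMeasurable_of_continuousOn {d : ℕ} {E : Type*} [TopologicalSpace E]
    [TopologicalSpace.PseudoMetrizableSpace E] {Ω : Set (Vec d)}
    (hΩ : IsOpen Ω) {μ : Measure (Vec d)} (hμ : μ Ωᶜ = 0) {φ : Vec d → E}
    (hφ : ContinuousOn φ Ω) : AEStronglyMeasurable φ μ := by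
  have h := hφ.aestronglyMeasurable (μ := μ) hΩ.measurableSet
  rwa [Measure.restrict_eq_self_of_ae_mem (ae_mem_of_measure_compl hμ)] at h

lemma continuousOn_gradient {d : ℕ} {Ω : Set (Vec d)} (hΩ : IsOpen Ω) {φ : Vec d → ℝ}
    (hφ : ContDiffOn ℝ 1 φ Ω) : ContinuousOn (gradient φ) Ω :=
  (InnerProductSpace.toDual ℝ (Vec d)).symm.continuous.comp_continuousOn
    (hφ.continuousOn_fderiv_of_isOpen hΩ le_rfl)

lemma differentiableAt_of_contDiffOn {d : ℕ} {Ω : Set (Vec d)} (hΩ : IsOpen Ω) {φ : Vec d → ℝ}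
    (hφ : ContDiffOn ℝ 1 φ Ω) {x : Vec d} (hx : x ∈ Ω) : DifferentiableAt ℝ φ x :=
  (hφ.contDiffAt (hΩ.mem_nhds hx)).differentiableAt one_ne_zero

lemma gradient_mul {d : ℕ} {φ ψ : Vec d → ℝ} {x : Vec d} (hφ : DifferentiableAt ℝ φ x)
    (hψ : DifferentiableAt ℝ ψ x) :
    gradient (fun y => φ y * ψ y) x = ψ x • gradient φ x + φ x • gradient ψ x := by
  apply (InnerProductSpace.toDual ℝ (Vec d)).injective
  simp only [map_add, map_smulₛₗ, toDual_gradient, conj_trivial]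
  rw [fderiv_fun_mul hφ hψ, add_comm]

lemma gradient_one_sub {d : ℕ} (ψ : Vec d → ℝ) (x : Vec d) :
    gradient (fun y => 1 - ψ y) x = - gradient ψ x := by
  apply (InnerProductSpace.toDual ℝ (Vec d)).injective
  simp only [map_neg, toDual_gradient]
  exact fderiv_const_sub (𝕜 := ℝ) (f := ψ) (x := x) 1

namespace IsBoundedC1

variable {d : ℕ} {Ω : Set (Vec d)} {φ : Vec d → ℝ} {M : ℝ}

lemma integrable (h : IsBoundedC1 Ω φ M) (hΩ : IsOpen Ω) {μ : Measure (Vec d)}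
    [IsFiniteMeasure μ] (hμ : μ Ωᶜ = 0) : Integrable φ μ := by
  refine .of_bound (aestronglyMeasurable_of_continuousOn hΩ hμ h.contDiffOn.continuousOn) M ?_
  filter_upwards [ae_mem_of_measure_compl hμ] with x hx using h.abs_le x hx

lemma aestronglyMeasurable_gradient (h : IsBoundedC1 Ω φ M) (hΩ : IsOpen Ω) {μ : Measure (Vec d)}
    (hμ : μ Ωᶜ = 0) : AEStronglyMeasurable (gradient φ) μ :=
  aestronglyMeasurable_of_continuousOn hΩ hμ (continuousOn_gradient hΩ h.contDiffOn)

lemma integrable_norm_gradient_sq (h : IsBoundedC1 Ω φ M) (hΩ : IsOpen Ω) {μ : Measure (Vec d)}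
    [IsFiniteMeasure μ] (hμ : μ Ωᶜ = 0) : Integrable (fun x => ‖gradient φ x‖ ^ 2) μ := by
  refine .of_bound ((h.aestronglyMeasurable_gradient hΩ hμ).norm.pow 2) (M ^ 2) ?_
  filter_upwards [ae_mem_of_measure_compl hμ] with x hx
  rw [Real.norm_of_nonneg (sq_nonneg _)]
  exact pow_le_pow_left₀ (norm_nonneg _) (h.norm_gradient_le x hx) 2

lemma norm_gradient_mul_le (h : IsBoundedC1 Ω φ M) (hΩ : IsOpen Ω) {ψ : Vec d → ℝ} {c : ℝ}
    (hψ : ContDiff ℝ 1 ψ) (hψ01 : ∀ x, ψ x ∈ Icc (0 : ℝ) 1) (hc : ∀ x, ‖gradient ψ x‖ ≤ c)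
    {x : Vec d} (hx : x ∈ Ω) :
    ‖gradient (fun y => φ y * ψ y) x‖ ≤ ψ x * ‖gradient φ x‖ + M * c := by
  rw [gradient_mul (differentiableAt_of_contDiffOn hΩ h.contDiffOn hx)
    (hψ.differentiable one_ne_zero x)]
  refine (norm_add_le _ _).trans ?_
  rw [norm_smul, norm_smul, Real.norm_of_nonneg (hψ01 x).1]
  have h1 : ‖φ x‖ ≤ M := h.abs_le x hx
  gcongr
  · exact (norm_nonneg _).trans h1
  · exact hc x

lemma mul (h : IsBoundedC1 Ω φ M) (hΩ : IsOpen Ω) {ψ : Vec d → ℝ} {c : ℝ}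
    (hψ : ContDiff ℝ 1 ψ) (hψ01 : ∀ x, ψ x ∈ Icc (0 : ℝ) 1) (hc : ∀ x, ‖gradient ψ x‖ ≤ c) :
    IsBoundedC1 Ω (fun y => φ y * ψ y) (M + M * c) := by
  have hM : ∀ x ∈ Ω, 0 ≤ M := fun x hx => (abs_nonneg _).trans (h.abs_le x hx)
  have hc0 : ∀ x ∈ Ω, 0 ≤ M * c := fun x hx => mul_nonneg (hM x hx) ((norm_nonneg _).trans (hc x))
  refine ⟨h.contDiffOn.mul hψ.contDiffOn, fun x hx => ?_, fun x hx => ?_⟩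
  · rw [abs_mul, abs_of_nonneg (hψ01 x).1]
    calc |φ x| * ψ x ≤ M * 1 :=
          mul_le_mul (h.abs_le x hx) (hψ01 x).2 (hψ01 x).1 (hM x hx)
      _ ≤ _ := by linarith [hc0 x hx]
  · refine (h.norm_gradient_mul_le hΩ hψ hψ01 hc hx).trans ?_
    gcongr
    calc ψ x * ‖gradient φ x‖ ≤ 1 * M :=
          mul_le_mul (hψ01 x).2 (h.norm_gradient_le x hx) (norm_nonneg _) zero_le_one
      _ = M := one_mul M

lemma isTestFunction_mul (h : IsBoundedC1 Ω φ M) (hΩ : IsOpen Ω) {ψ : Vec d → ℝ} {c : ℝ}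
    (hψ : ContDiff ℝ 1 ψ) (hψ01 : ∀ x, ψ x ∈ Icc (0 : ℝ) 1) (hc : ∀ x, ‖gradient ψ x‖ ≤ c)
    (hs : Bornology.IsBounded (Function.support ψ)) :
    IsTestFunction Ω (fun y => φ y * ψ y) := by
  have h' := h.mul hΩ hψ hψ01 hc
  refine ⟨h'.contDiffOn, ⟨_, fun x hx => ⟨h'.abs_le x hx, h'.norm_gradient_le x hx⟩⟩,
    hs.subset fun x hx => ?_⟩
  exact right_ne_zero_of_mul hx.2

end IsBoundedC1

/-! ### Extension of the continuity equation to bounded `C¹` functions -/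

/-- A curve of probability measures on `Ω` driven by a vector field bounded in `L²`. No
measurability of the field is assumed. -/
structure IsBoundedFlow {d : ℕ} (Ω : Set (Vec d)) (T : ℝ) (ρ : ℝ → Measure (Vec d))
    (w : ℝ → Vec d → Vec d) (B : ℝ≥0) : Prop where
  isOpen : IsOpen Ω
  prob : ∀ t ∈ Icc 0 T, IsProbabilityMeasure (ρ t)
  carried : ∀ t ∈ Icc 0 T, ρ t Ωᶜ = 0
  eq : SolvesContinuityEq Ω T ρ w
  bound : ∀ t ∈ Icc 0 T, eLpNorm (w t) 2 (ρ t) ≤ B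

namespace IsBoundedFlow

variable {d : ℕ} {Ω : Set (Vec d)} {T : ℝ} {ρ : ℝ → Measure (Vec d)} {w : ℝ → Vec d → Vec d}
  {B : ℝ≥0} {φ : Vec d → ℝ} {M K : ℝ}

lemma abs_integral_inner_gradient_le (F : IsBoundedFlow Ω T ρ w B) (hφ : IsBoundedC1 Ω φ M)
    (hK : 0 ≤ K) {t : ℝ} (ht : t ∈ Icc 0 T) (hφK : ∫ x, ‖gradient φ x‖ ^ 2 ∂(ρ t) ≤ K ^ 2) :
    |∫ x, inner ℝ (gradient φ x) (w t x) ∂(ρ t)| ≤ K * B := by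
  have := F.prob t ht
  by_cases hm : AEStronglyMeasurable (fun x => inner ℝ (gradient φ x) (w t x)) (ρ t)
  · exact (abs_integral_le_integral_abs).trans
      (integrable_and_integral_abs_le_of_eLpNorm_two_le (F.bound t ht)
        (hφ.aestronglyMeasurable_gradient F.isOpen (F.carried t ht)).norm
        (hφ.integrable_norm_gradient_sq F.isOpen (F.carried t ht)) hK hφK hm
        (Eventually.of_forall fun x => abs_real_inner_le_norm _ _)).2
  -- A non-measurable integrand has integral `0` by convention, so the bound still holds.
  · rw [integral_undef fun h => hm h.1, abs_zero]
    positivity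

lemma abs_integral_sub_le_of_isTestFunction (F : IsBoundedFlow Ω T ρ w B)
    (hφ : IsBoundedC1 Ω φ M) (hφt : IsTestFunction Ω φ) (hK : 0 ≤ K)
    (hφK : ∀ t ∈ Icc 0 T, ∫ x, ‖gradient φ x‖ ^ 2 ∂(ρ t) ≤ K ^ 2) {s t : ℝ} (hs : s ∈ Icc 0 T)
    (ht : t ∈ Icc 0 T) : |∫ x, φ x ∂(ρ t) - ∫ x, φ x ∂(ρ s)| ≤ K * B * |t - s| :=
  (convex_Icc 0 T).norm_image_sub_le_of_norm_hasDerivWithin_le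
    (f := fun r => ∫ x, φ x ∂(ρ r)) (F.eq φ hφt)
    (fun r hr => F.abs_integral_inner_gradient_le hφ hK hr (hφK r hr)) hs ht

lemma tendsto_integral_mul_cutoff (F : IsBoundedFlow Ω T ρ w B) (hφ : IsBoundedC1 Ω φ M)
    {χ : ℕ → Vec d → ℝ} (hχ : ∀ n, ContDiff ℝ 1 (χ n)) (hχ01 : ∀ n x, χ n x ∈ Icc (0 : ℝ) 1)
    (hχ1 : ∀ x, ∀ᶠ n in atTop, χ n x = 1) {t : ℝ} (ht : t ∈ Icc 0 T) :
    Tendsto (fun n => ∫ x, φ x * χ n x ∂(ρ t)) atTop (𝓝 (∫ x, φ x ∂(ρ t))) := by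
  have := F.prob t ht
  have hi := hφ.integrable F.isOpen (F.carried t ht)
  refine tendsto_integral_of_dominated_convergence (fun x => |φ x|)
    (fun n => hi.1.mul (hχ n).continuous.aestronglyMeasurable) hi.abs
    (fun n => Eventually.of_forall fun x => ?_) (Eventually.of_forall fun x => ?_)
  · rw [norm_mul, Real.norm_eq_abs, Real.norm_of_nonneg (hχ01 n x).1]
    exact mul_le_of_le_one_right (abs_nonneg _) (hχ01 n x).2
  · refine tendsto_const_nhds.congr' ?_
    filter_upwards [hχ1 x] with n hn
    rw [hn, mul_one]

/-- The mean value inequality applies to the truncations `φ χ_n`, and their Lipschitz constants tend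
to `K B` because the gradients of the cutoffs tend to `0` uniformly. -/
lemma abs_integral_sub_le (F : IsBoundedFlow Ω T ρ w B)
    (hφ : IsBoundedC1 Ω φ M) (hK : 0 ≤ K)
    (hφK : ∀ t ∈ Icc 0 T, ∫ x, ‖gradient φ x‖ ^ 2 ∂(ρ t) ≤ K ^ 2) {s t : ℝ} (hs : s ∈ Icc 0 T)
    (ht : t ∈ Icc 0 T) : |∫ x, φ x ∂(ρ t) - ∫ x, φ x ∂(ρ s)| ≤ K * B * |t - s| := by
  obtain ⟨c, hc0, χ, hχ, hχ01, hχb, hχc, hχ1⟩ := exists_cutoff d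
  have hcn : ∀ n : ℕ, 0 ≤ c / ((n : ℝ) + 1) := fun n => by positivity
  have hM : 0 ≤ M := by
    have := F.prob s hs
    obtain ⟨x, hx⟩ := (ae_mem_of_measure_compl (F.carried s hs)).exists
    exact (abs_nonneg _).trans (hφ.abs_le x hx)
  -- With `c_n = c / (n + 1)`, the expression under the root comes from expanding `(‖∇φ‖ + M c_n)²`
  -- and using `‖∇φ‖ ≤ M` in the cross term.
  let L : ℕ → ℝ := fun n =>
    √(K ^ 2 + (2 * M * (M * (c / ((n : ℝ) + 1))) + (M * (c / ((n : ℝ) + 1))) ^ 2))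
  have hL : Tendsto L atTop (𝓝 K) := by
    have hlim : Tendsto (fun n : ℕ => c / ((n : ℝ) + 1)) atTop (𝓝 0) :=
      tendsto_div_natCast_add_one c
    have := ((((hlim.const_mul M).const_mul (2 * M)).add
      ((hlim.const_mul M).pow 2)).const_add (K ^ 2)).sqrt
    simpa [Real.sqrt_sq hK] using this
  have hn : ∀ n : ℕ, |∫ x, φ x * χ n x ∂(ρ t) - ∫ x, φ x * χ n x ∂(ρ s)| ≤ L n * B * |t - s| := by
    intro n
    refine F.abs_integral_sub_le_of_isTestFunction
      (hφ.mul F.isOpen (hχ n) (hχ01 n) (hχc n))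
      (hφ.isTestFunction_mul F.isOpen (hχ n) (hχ01 n) (hχc n) (hχb n)) (Real.sqrt_nonneg _)
      (fun r hr => ?_) hs ht
    have := F.prob r hr
    have h0 : 0 ≤ M * (c / ((n : ℝ) + 1)) := mul_nonneg hM (hcn n)
    rw [Real.sq_sqrt (by positivity)]
    have hi := hφ.integrable_norm_gradient_sq F.isOpen (F.carried r hr)
    calc ∫ x, ‖gradient (fun y => φ y * χ n y) x‖ ^ 2 ∂(ρ r)
        ≤ ∫ x, (‖gradient φ x‖ ^ 2 + (2 * M * (M * (c / ((n : ℝ) + 1)))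
            + (M * (c / ((n : ℝ) + 1))) ^ 2)) ∂(ρ r) := by
          refine integral_mono_ae ((hφ.mul F.isOpen (hχ n) (hχ01 n)
            (hχc n)).integrable_norm_gradient_sq F.isOpen (F.carried r hr))
            (hi.add (integrable_const _)) ?_
          filter_upwards [ae_mem_of_measure_compl (F.carried r hr)] with x hx
          have h1 := hφ.norm_gradient_mul_le F.isOpen (hχ n) (hχ01 n) (hχc n) hx
          have h2 : χ n x * ‖gradient φ x‖ ≤ ‖gradient φ x‖ :=
            mul_le_of_le_one_left (norm_nonneg _) (hχ01 n x).2
          have h3 := hφ.norm_gradient_le x hx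
          calc _ ≤ (‖gradient φ x‖ + M * (c / ((n : ℝ) + 1))) ^ 2 := by
                gcongr
                linarith
            _ ≤ _ := by nlinarith
      _ = ∫ x, ‖gradient φ x‖ ^ 2 ∂(ρ r) + (2 * M * (M * (c / ((n : ℝ) + 1)))
            + (M * (c / ((n : ℝ) + 1))) ^ 2) := by
          rw [integral_add hi (integrable_const _)]
          simp
      _ ≤ _ := by linarith [hφK r hr]
  refine le_of_tendsto_of_tendsto' (((F.tendsto_integral_mul_cutoff hφ hχ hχ01 hχ1 ht).sub
    (F.tendsto_integral_mul_cutoff hφ hχ hχ01 hχ1 hs)).abs)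
    ((hL.mul_const _).mul_const _) hn

lemma isBoundedC1_one : IsBoundedC1 Ω (fun _ : Vec d => (1 : ℝ)) 1 :=
  ⟨contDiffOn_const, fun x _ => by simp, fun x _ => by simp [gradient]⟩

/-- Bounded `C¹` functions are, uniformly along the flow, approximated by test functions. -/
lemma exists_isTestFunction_mul (F : IsBoundedFlow Ω T ρ w B) (hT : 0 ≤ T)
    (hφ : IsBoundedC1 Ω φ M) {ε : ℝ} (hε : 0 < ε) :
    ∃ (ψ : Vec d → ℝ) (M' M'' : ℝ), IsTestFunction Ω (fun x => φ x * ψ x) ∧ ContDiff ℝ 1 ψ ∧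
      IsBoundedC1 Ω (fun x => φ x * ψ x) M' ∧
      IsBoundedC1 Ω (fun x => φ x * (1 - ψ x)) M'' ∧
      ∀ t ∈ Icc 0 T, ∫ x, ‖gradient (fun y => φ y * (1 - ψ y)) x‖ ^ 2 ∂(ρ t) ≤ ε ^ 2 := by
  obtain ⟨c, hc0, χ, hχ, hχ01, hχb, hχc, hχ1⟩ := exists_cutoff d
  have h0 : (0 : ℝ) ∈ Icc 0 T := ⟨le_rfl, hT⟩
  have hcn : ∀ n : ℕ, 0 ≤ c / ((n : ℝ) + 1) := fun n => by positivity
  have hM : 0 ≤ M := by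
    have := F.prob 0 h0
    obtain ⟨x, hx⟩ := (ae_mem_of_measure_compl (F.carried 0 h0)).exists
    exact (abs_nonneg _).trans (hφ.abs_le x hx)
  have hint : ∀ n, ∀ t ∈ Icc 0 T, Integrable (χ n) (ρ t) := fun n t ht => by
    have := F.prob t ht
    exact .of_bound (hχ n).continuous.aestronglyMeasurable 1 (Eventually.of_forall fun x => by
      rw [Real.norm_of_nonneg (hχ01 n x).1]
      exact (hχ01 n x).2)
  -- Uniform tightness: the integral of `χ n` changes at rate at most `c / (n + 1) * B`, so the mass
  -- missed by the cutoff at time `t` is controlled by that at time `0`.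
  have htight : ∀ n, ∀ t ∈ Icc 0 T, 1 - ∫ x, χ n x ∂(ρ t)
      ≤ 1 - ∫ x, χ n x ∂(ρ 0) + c / ((n : ℝ) + 1) * B * T := by
    intro n t ht
    have h1 : IsBoundedC1 Ω (χ n) (1 + 1 * (c / ((n : ℝ) + 1))) := by
      simpa using isBoundedC1_one.mul F.isOpen (hχ n) (hχ01 n) (hχc n)
    have h2 : IsTestFunction Ω (χ n) := by
      simpa using isBoundedC1_one.isTestFunction_mul F.isOpen (hχ n) (hχ01 n) (hχc n) (hχb n)
    have h3 := F.abs_integral_sub_le_of_isTestFunction h1 h2 (hcn n) (fun r hr => by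
      have := F.prob r hr
      calc ∫ x, ‖gradient (χ n) x‖ ^ 2 ∂(ρ r) ≤ ∫ _, (c / ((n : ℝ) + 1)) ^ 2 ∂(ρ r) := by
            refine integral_mono (h1.integrable_norm_gradient_sq F.isOpen (F.carried r hr))
              (integrable_const _) fun x => ?_
            exact pow_le_pow_left₀ (norm_nonneg _) (hχc n x) 2
        _ = _ := by simp) h0 ht
    have h4 : c / ((n : ℝ) + 1) * B * |t - 0| ≤ c / ((n : ℝ) + 1) * B * T := by
      rw [sub_zero, abs_of_nonneg ht.1]
      gcongr
      exact ht.2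
    linarith [neg_abs_le (∫ x, χ n x ∂(ρ t) - ∫ x, χ n x ∂(ρ 0))]
  have hlim : Tendsto (fun n : ℕ => c / ((n : ℝ) + 1)) atTop (𝓝 0) :=
    tendsto_div_natCast_add_one c
  have hlim2 : Tendsto (fun n : ℕ => 2 * M ^ 2 * ((1 - ∫ x, χ n x ∂(ρ 0)
      + c / ((n : ℝ) + 1) * B * T) + (c / ((n : ℝ) + 1)) ^ 2)) atTop (𝓝 0) := by
    have h1 := F.tendsto_integral_mul_cutoff isBoundedC1_one hχ hχ01 hχ1 h0
    have := F.prob 0 h0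
    simp only [one_mul, integral_const, probReal_univ, smul_eq_mul, mul_one] at h1
    have := ((((h1.const_sub 1).add ((hlim.mul_const (B : ℝ)).mul_const T))).add
      (hlim.pow 2)).const_mul (2 * M ^ 2)
    simpa using this
  obtain ⟨n, hn⟩ := (hlim2.eventually (gt_mem_nhds (pow_pos hε 2))).exists
  have hχ' : ContDiff ℝ 1 fun x => 1 - χ n x := contDiff_const.sub (hχ n)
  have hχ01' : ∀ x, 1 - χ n x ∈ Icc (0 : ℝ) 1 := fun x => by
    have := hχ01 n x
    constructor <;> linarith [this.1, this.2]
  have hχc' : ∀ x, ‖gradient (fun y => 1 - χ n y) x‖ ≤ c / ((n : ℝ) + 1) := fun x => by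
    rw [gradient_one_sub, norm_neg]
    exact hχc n x
  refine ⟨χ n, _, _, hφ.isTestFunction_mul F.isOpen (hχ n) (hχ01 n) (hχc n) (hχb n), hχ n,
    hφ.mul F.isOpen (hχ n) (hχ01 n) (hχc n), hφ.mul F.isOpen hχ' hχ01' hχc', fun t ht => ?_⟩
  have := F.prob t ht
  refine le_trans ?_ hn.le
  calc ∫ x, ‖gradient (fun y => φ y * (1 - χ n y)) x‖ ^ 2 ∂(ρ t)
      ≤ ∫ x, (2 * M ^ 2 * ((1 - χ n x) + (c / ((n : ℝ) + 1)) ^ 2)) ∂(ρ t) := by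
        refine integral_mono_ae ((hφ.mul F.isOpen hχ' hχ01' hχc').integrable_norm_gradient_sq
          F.isOpen (F.carried t ht))
          ((((integrable_const _).sub (hint n t ht)).add (integrable_const _)).const_mul _) ?_
        filter_upwards [ae_mem_of_measure_compl (F.carried t ht)] with x hx
        have h1 := hφ.norm_gradient_mul_le F.isOpen hχ' hχ01' hχc' hx
        have h3 := hφ.norm_gradient_le x hx
        have h4 := hχ01' x
        -- This replaces the squared cutoff in the gradient bound by the missed mass that `htight`
        -- controls.
        have h5 : (1 - χ n x) ^ 2 ≤ 1 - χ n x := by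
          rw [sq]
          exact mul_le_of_le_one_left h4.1 h4.2
        calc _ ≤ ((1 - χ n x) * M + M * (c / ((n : ℝ) + 1))) ^ 2 := by
              refine pow_le_pow_left₀ (norm_nonneg _) (h1.trans ?_) 2
              gcongr
              exact h4.1
          _ ≤ 2 * (((1 - χ n x) * M) ^ 2 + (M * (c / ((n : ℝ) + 1))) ^ 2) := add_sq_le
          _ = 2 * M ^ 2 * ((1 - χ n x) ^ 2 + (c / ((n : ℝ) + 1)) ^ 2) := by ring
          _ ≤ _ := by gcongr
    _ = 2 * M ^ 2 * ((1 - ∫ x, χ n x ∂(ρ t)) + (c / ((n : ℝ) + 1)) ^ 2) := by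
        rw [integral_const_mul, integral_add (f := fun x => 1 - χ n x)
          ((integrable_const _).sub (hint n t ht)) (integrable_const _),
          integral_sub (integrable_const _) (hint n t ht)]
        simp
    _ ≤ _ := by
        gcongr
        exact htight n t ht

lemma integrable_inner_gradient (F : IsBoundedFlow Ω T ρ w B) (hφ : IsBoundedC1 Ω φ M)
    (hK : 0 ≤ K) {t : ℝ} (ht : t ∈ Icc 0 T) (hw : AEStronglyMeasurable (w t) (ρ t))
    (hφK : ∫ x, ‖gradient φ x‖ ^ 2 ∂(ρ t) ≤ K ^ 2) :
    Integrable (fun x => inner ℝ (gradient φ x) (w t x)) (ρ t) ∧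
      Integrable (fun x => ‖gradient φ x‖ * ‖w t x‖) (ρ t) ∧
      ∫ x, ‖gradient φ x‖ * ‖w t x‖ ∂(ρ t) ≤ K * B := by
  have := F.prob t ht
  have hm := hφ.aestronglyMeasurable_gradient F.isOpen (F.carried t ht)
  have hi := hφ.integrable_norm_gradient_sq F.isOpen (F.carried t ht)
  have h1 := integrable_and_integral_abs_le_of_eLpNorm_two_le (F.bound t ht) hm.norm hi hK hφK
    (hm.norm.mul hw.norm) (Eventually.of_forall fun x => by
      simp [abs_mul])
  refine ⟨(integrable_and_integral_abs_le_of_eLpNorm_two_le (F.bound t ht) hm.norm hi hK hφK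
    (hm.inner hw) (Eventually.of_forall fun x => abs_real_inner_le_norm _ _)).1, h1.1, ?_⟩
  simpa [abs_mul] using h1.2

/-- Split `φ = φ ψ + φ (1 - ψ)`. The first part is a test function. The gradient of the second is
small in `L²(ρ_s)` uniformly in `s`, so both its increment and its candidate derivative contribute
at most `ε / 3 * |s - t|`. Measurability of `w t` makes the candidate derivative additive in `φ`. -/
theorem hasDerivWithinAt_integral (F : IsBoundedFlow Ω T ρ w B) (hφ : IsBoundedC1 Ω φ M)
    {t : ℝ} (ht : t ∈ Icc 0 T) (hw : AEStronglyMeasurable (w t) (ρ t)) :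
    HasDerivWithinAt (fun s => ∫ x, φ x ∂(ρ s))
      (∫ x, inner ℝ (gradient φ x) (w t x) ∂(ρ t)) (Icc 0 T) t := by
  rw [hasDerivWithinAt_iff_isLittleO, Asymptotics.isLittleO_iff]
  intro ε hε
  -- Adding `1` keeps the denominator positive when `B = 0`.
  have hδ : 0 < ε / (3 * (B + 1)) := by positivity
  have hδB : ε / (3 * (B + 1)) * B ≤ ε / 3 := by
    rw [div_mul_eq_mul_div, div_le_div_iff₀ (by positivity) (by positivity)]
    nlinarith [B.2]
  obtain ⟨ψ, M', M'', hψt, hψ, hψ1, hψ2, hψK⟩ :=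
    F.exists_isTestFunction_mul (ht.1.trans ht.2) hφ hδ
  have h1 := (hasDerivWithinAt_iff_isLittleO.1 (F.eq _ hψt t ht))
  rw [Asymptotics.isLittleO_iff] at h1
  have hsplit : ∀ s ∈ Icc 0 T, ∫ x, φ x ∂(ρ s)
      = ∫ x, φ x * ψ x ∂(ρ s) + ∫ x, φ x * (1 - ψ x) ∂(ρ s) := fun s hs => by
    have := F.prob s hs
    rw [← integral_add (hψ1.integrable F.isOpen (F.carried s hs))
      (hψ2.integrable F.isOpen (F.carried s hs))]
    exact integral_congr_ae (Eventually.of_forall fun x => by ring)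
  have := F.prob t ht
  have hsplit' : ∫ x, inner ℝ (gradient φ x) (w t x) ∂(ρ t)
      = ∫ x, inner ℝ (gradient (fun y => φ y * ψ y) x) (w t x) ∂(ρ t)
        + ∫ x, inner ℝ (gradient (fun y => φ y * (1 - ψ y)) x) (w t x) ∂(ρ t) := by
    -- The truncated part needs no smallness: `K` is the `L²` norm of its own gradient.
    rw [← integral_add (F.integrable_inner_gradient hψ1 (Real.sqrt_nonneg _) ht hw
      (Real.sq_sqrt (integral_nonneg fun x => sq_nonneg _)).ge).1
      (F.integrable_inner_gradient hψ2 hδ.le ht hw (hψK t ht)).1]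
    refine integral_congr_ae ?_
    filter_upwards [ae_mem_of_measure_compl (F.carried t ht)] with x hx
    have hd := differentiableAt_of_contDiffOn F.isOpen hφ.contDiffOn hx
    have hd' := hψ.differentiable one_ne_zero x
    rw [← inner_add_left, gradient_mul hd hd', gradient_mul hd (hd'.const_sub 1), gradient_one_sub]
    congr 1
    module
  filter_upwards [h1 (show 0 < ε / 3 by positivity), self_mem_nhdsWithin] with s hs hsT
  have h2 := F.abs_integral_sub_le hψ2 hδ.le hψK ht hsT
  have h3 := F.abs_integral_inner_gradient_le hψ2 hδ.le ht (hψK t ht)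
  rw [hsplit s hsT, hsplit t ht, hsplit']
  set a := ∫ x, inner ℝ (gradient (fun y => φ y * (1 - ψ y)) x) (w t x) ∂(ρ t)
  set a' := ∫ x, inner ℝ (gradient (fun y => φ y * ψ y) x) (w t x) ∂(ρ t)
  simp only [Real.norm_eq_abs, smul_eq_mul] at hs ⊢
  have h4 : |(s - t) * a| ≤ ε / 3 * |s - t| := by
    rw [abs_mul, mul_comm]
    exact mul_le_mul_of_nonneg_right (h3.trans hδB) (abs_nonneg _)
  have h5 := h2.trans (mul_le_mul_of_nonneg_right hδB (abs_nonneg _))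
  rw [abs_le] at *
  constructor <;> linarith [hs.1, hs.2, h4.1, h4.2, h5.1, h5.2]

end IsBoundedFlow

/-! ### Identification of the first variation -/

/-- From `a ≤ a + ε b ≤ 2 max(a, b)`. The bound does not depend on `ε` and so yields a majorant as
`ε ↓ 0`. -/
lemma abs_log_add_le {a b : ℝ} (ha : 0 < a) (hb : 0 < b) {ε : ℝ} (h0 : 0 ≤ ε) (h1 : ε ≤ 1) :
    |Real.log (a + ε * b)| ≤ |Real.log a| + |Real.log b| + Real.log 2 := by
  have hεb : ε * b ≤ b := mul_le_of_le_one_left hb.le h1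
  have hεb0 : 0 ≤ ε * b := by positivity
  have hl : Real.log a ≤ Real.log (a + ε * b) := Real.log_le_log ha (by linarith)
  have hu : Real.log (a + ε * b) ≤ Real.log (2 * max a b) := by
    refine Real.log_le_log (by linarith) ?_
    linarith [le_max_left a b, le_max_right a b]
  have hm : Real.log (max a b) ≤ |Real.log a| + |Real.log b| := by
    rcases max_choice a b with h | h <;> rw [h] <;>
      linarith [abs_nonneg (Real.log a), abs_nonneg (Real.log b), le_abs_self (Real.log a),
        le_abs_self (Real.log b)]
  rw [Real.log_mul two_ne_zero (lt_max_of_lt_left ha).ne'] at hu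
  have h2 : 0 ≤ Real.log 2 := Real.log_nonneg one_le_two
  rw [abs_le]
  constructor <;> linarith [neg_abs_le (Real.log a), abs_nonneg (Real.log b)]

/-- By `log (1 + u) ≤ u` at `u = ε b / a`. After division by `ε`, the entropy increment is dominated
by `b`, here the integrable density `q(z|x)`. -/
lemma mul_log_add_sub_log_mem_Icc {a b : ℝ} (ha : 0 < a) (hb : 0 < b) {ε : ℝ} (h0 : 0 ≤ ε) :
    a * (Real.log (a + ε * b) - Real.log a) ∈ Icc 0 (ε * b) := by
  have h2 : 0 ≤ ε * b := by positivity
  refine ⟨mul_nonneg ha.le (sub_nonneg.2 (Real.log_le_log ha (by linarith))), ?_⟩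
  rw [← Real.log_div (by linarith) ha.ne', add_div, div_self ha.ne', mul_comm,
    ← le_div_iff₀ ha]
  linarith [Real.log_le_sub_one_of_pos (show 0 < 1 + ε * b / a by positivity)]

lemma tendsto_mul_log_add_sub_log_div {a b : ℝ} (ha : 0 < a) :
    Tendsto (fun ε : ℝ => a * (Real.log (a + ε * b) - Real.log a) / ε) (𝓝[>] 0) (𝓝 b) := by
  have h1 : HasDerivAt (fun ε : ℝ => a * Real.log (a + ε * b)) b 0 := by
    have h2 : HasDerivAt (fun ε : ℝ => a + ε * b) b 0 := by
      simpa using ((hasDerivAt_id (0 : ℝ)).mul_const b).const_add a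
    have := (h2.log (by simpa using ha.ne')).const_mul a
    simpa [mul_div_cancel₀, ha.ne'] using this
  have := h1.hasDerivWithinAt (s := Ioi 0)
  rw [hasDerivWithinAt_iff_tendsto_slope' (by simp)] at this
  refine this.congr fun ε => ?_
  simp [slope_def_field, mul_sub]

namespace IsDensityFamily

variable {d : ℕ} {Z : Type*} [MeasurableSpace Z] {ν : Measure Z} {Ω : Set (Vec d)}
  {q : Vec d → Z → ℝ} {μ : Measure (Vec d)}

lemma exists_isBoundedC1 (hq : IsDensityFamily ν Ω q) (z : Z) :
    ∃ M, IsBoundedC1 Ω (fun x => q x z) M := by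
  obtain ⟨M, hM⟩ := hq.bounded z
  refine ⟨M, hq.contDiffOn z, fun x hx => ?_, fun x hx => (hM x hx).2⟩
  rw [abs_of_pos (hq.pos x hx z)]
  exact (hM x hx).1

lemma measurable_right (hq : IsDensityFamily ν Ω q) (x : Vec d) : Measurable (q x) :=
  hq.measurable.comp measurable_prodMk_left

lemma integrable_right (hq : IsDensityFamily ν Ω q) {x : Vec d} (hx : x ∈ Ω) :
    Integrable (q x) ν := by
  by_contra h
  have := hq.integral_eq_one x hx
  rw [integral_undef h] at this
  exact zero_ne_one this

lemma integrable_left (hq : IsDensityFamily ν Ω q) (hΩ : IsOpen Ω) [IsFiniteMeasure μ]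
    (hμ : μ Ωᶜ = 0) (z : Z) : Integrable (fun x => q x z) μ := by
  obtain ⟨M, hM⟩ := hq.exists_isBoundedC1 z
  exact hM.integrable hΩ hμ

lemma measurable_mixture (hq : IsDensityFamily ν Ω q) (μ : Measure (Vec d)) [SFinite μ] :
    Measurable (mixture q μ) :=
  (hq.measurable.stronglyMeasurable.integral_prod_left (μ := μ)).measurable

lemma mixture_pos (hq : IsDensityFamily ν Ω q) (hΩ : IsOpen Ω) [IsProbabilityMeasure μ]
    (hμ : μ Ωᶜ = 0) (z : Z) : 0 < mixture q μ z := by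
  have hpos : ∀ᵐ x ∂μ, 0 < q x z := by
    filter_upwards [ae_mem_of_measure_compl hμ] with x hx using hq.pos x hx z
  unfold mixture
  rw [integral_pos_iff_support_of_nonneg_ae (hpos.mono fun x hx => hx.le)
    (hq.integrable_left hΩ hμ z)]
  have : Function.support (fun x => q x z) =ᵐ[μ] univ :=
    eventuallyEq_univ.2 (hpos.mono fun x hx => hx.ne')
  rw [measure_congr this]
  simp

/-- Tonelli: as `q` is positive on `Ω`, integrating the absolute value over the parameter gives
exactly `q_μ |ψ|`. -/
lemma integrable_prod (hq : IsDensityFamily ν Ω q) (hΩ : IsOpen Ω) [IsProbabilityMeasure μ]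
    [SigmaFinite ν] (hμ : μ Ωᶜ = 0) {ψ : Z → ℝ} (hψ : Measurable ψ)
    (hi : Integrable (fun z => mixture q μ z * ψ z) ν) :
    Integrable (fun p : Vec d × Z => q p.1 p.2 * ψ p.2) (μ.prod ν) := by
  have hm : Measurable fun p : Vec d × Z => q p.1 p.2 * ψ p.2 :=
    hq.measurable.mul (hψ.comp measurable_snd)
  rw [integrable_prod_iff' hm.aestronglyMeasurable]
  refine ⟨Eventually.of_forall fun z => (hq.integrable_left hΩ hμ z).mul_const (ψ z), ?_⟩
  refine hi.norm.congr (Eventually.of_forall fun z => ?_)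
  simp only [norm_mul, integral_mul_const, Real.norm_of_nonneg (hq.mixture_pos hΩ hμ z).le]
  congr 1
  refine integral_congr_ae ?_
  filter_upwards [ae_mem_of_measure_compl hμ] with x hx
  rw [Real.norm_of_nonneg (hq.pos x hx z).le]

lemma integral_integral (hq : IsDensityFamily ν Ω q) (hΩ : IsOpen Ω) [IsProbabilityMeasure μ]
    [SigmaFinite ν] (hμ : μ Ωᶜ = 0) {ψ : Z → ℝ} (hψ : Measurable ψ)
    (hi : Integrable (fun z => mixture q μ z * ψ z) ν) :
    ∫ x, ∫ z, q x z * ψ z ∂ν ∂μ = ∫ z, mixture q μ z * ψ z ∂ν := by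
  rw [integral_integral_swap (f := fun x z => q x z * ψ z) (hq.integrable_prod hΩ hμ hψ hi)]
  simp only [integral_mul_const]
  rfl

lemma mixture_add_dirac (hq : IsDensityFamily ν Ω q) (hΩ : IsOpen Ω) [IsProbabilityMeasure μ]
    (hμ : μ Ωᶜ = 0) (x : Vec d) {ε : ℝ} (hε : 0 ≤ ε) (z : Z) :
    mixture q (μ + ENNReal.ofReal ε • Measure.dirac x) z = mixture q μ z + ε * q x z := by
  unfold mixture
  rw [integral_add_measure (hq.integrable_left hΩ hμ z)
    ((integrable_dirac (by simp)).smul_measure ENNReal.ofReal_ne_top), integral_smul_measure,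
    integral_dirac, ENNReal.toReal_ofReal hε, smul_eq_mul]

/-- The perturbation enters twice: inside the logarithm, integrated against the old mixture, and
through the added mass at `x`, integrated against `q(·|x)`. These are the two corrections to the
unperturbed value. -/
lemma negELBO_add_dirac [SigmaFinite ν] (hq : IsDensityFamily ν Ω q) (hΩ : IsOpen Ω)
    [IsProbabilityMeasure μ] (hμ : μ Ωᶜ = 0) {f : Z → ℝ} (hf : Measurable f)
    (hi : Integrable (fun z => mixture q μ z * (f z + Real.log (mixture q μ z))) ν)
    {x : Vec d} (hx : x ∈ Ω) {ε : ℝ} (hε : 0 < ε) :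
    Integrable (fun z => mixture q μ z *
        (Real.log (mixture q μ z + ε * q x z) - Real.log (mixture q μ z))) ν ∧
    negELBO ν q f (μ + ENNReal.ofReal ε • Measure.dirac x) =
      negELBO ν q f μ + ∫ z, mixture q μ z *
        (Real.log (mixture q μ z + ε * q x z) - Real.log (mixture q μ z)) ∂ν +
      ε * ∫ z, q x z * (f z + Real.log (mixture q μ z + ε * q x z)) ∂ν := by
  have hmm := hq.measurable_mixture μ
  have hqm := hq.measurable_right x
  have hi1 : Integrable (fun z => mixture q μ z *
        (Real.log (mixture q μ z + ε * q x z) - Real.log (mixture q μ z))) ν := by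
    refine ((hq.integrable_right hx).const_mul ε).mono'
      (Measurable.aestronglyMeasurable (by fun_prop)) (Eventually.of_forall fun z => ?_)
    have := mul_log_add_sub_log_mem_Icc (hq.mixture_pos hΩ hμ z) (hq.pos x hx z) hε.le
    rw [Real.norm_of_nonneg this.1]
    exact this.2
  refine ⟨hi1, ?_⟩
  have hψ : Measurable fun z => f z + Real.log (mixture q μ z + ε * q x z) := by fun_prop
  have heq : ∀ z, mixture q μ z * (f z + Real.log (mixture q μ z + ε * q x z))
      = mixture q μ z * (f z + Real.log (mixture q μ z)) + mixture q μ z *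
        (Real.log (mixture q μ z + ε * q x z) - Real.log (mixture q μ z)) := fun z => by ring
  have hi2 : Integrable (fun z => mixture q μ z *
      (f z + Real.log (mixture q μ z + ε * q x z))) ν := by
    simp only [heq]
    exact hi.add hi1
  have h1 : negELBO ν q f μ = ∫ z, mixture q μ z * (f z + Real.log (mixture q μ z)) ∂ν :=
    hq.integral_integral hΩ hμ (by fun_prop) hi
  have h2 : ∫ y, ∫ z, q y z * (f z + Real.log (mixture q μ z + ε * q x z)) ∂ν ∂μ =
      ∫ z, mixture q μ z * (f z + Real.log (mixture q μ z + ε * q x z)) ∂ν :=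
    hq.integral_integral hΩ hμ hψ hi2
  rw [h1, ← integral_add hi hi1]
  simp only [← heq]
  rw [← h2]
  unfold negELBO
  simp only [hq.mixture_add_dirac hΩ hμ x hε.le]
  rw [integral_add_measure (hq.integrable_prod hΩ hμ hψ hi2).integral_prod_left
    ((integrable_dirac (by simp)).smul_measure ENNReal.ofReal_ne_top), integral_smul_measure,
    integral_dirac, ENNReal.toReal_ofReal hε.le, smul_eq_mul]

/-- A first variation of the negated ELBO is given by its value on Dirac masses. -/
theorem eq_of_isFirstVariation [SigmaFinite ν] (hq : IsDensityFamily ν Ω q) (hΩ : IsOpen Ω)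
    [IsProbabilityMeasure μ] (hμ : μ Ωᶜ = 0) {f : Z → ℝ} (hf : Measurable f)
    (hi : Integrable (fun z => mixture q μ z * (f z + Real.log (mixture q μ z))) ν)
    {x : Vec d} (hx : x ∈ Ω) (hfx : Integrable (fun z => q x z * |f z|) ν)
    (hlog : Integrable (fun z => q x z * |Real.log (mixture q μ z)|) ν)
    (hent : Integrable (fun z => q x z * Real.log (q x z)) ν)
    {g : Vec d → ℝ} (hg : IsFirstVariation (negELBO ν q f) Ω μ g) :
    g x = ∫ z, q x z * (f z + Real.log (mixture q μ z) + 1) ∂ν := by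
  have hmm := hq.measurable_mixture μ
  have hqm := hq.measurable_right x
  -- Dirac masses are admissible directions, so `g` is determined at every point of `Ω`, not just
  -- almost everywhere.
  obtain ⟨-, hlim⟩ := hg (Measure.dirac x) inferInstance
    ⟨{x}, isCompact_singleton, singleton_subset_iff.2 hx, by simp⟩
  rw [integral_dirac] at hlim
  refine tendsto_nhds_unique hlim ?_
  have hbd : Integrable (fun z => q x z + q x z * |f z| + q x z * |Real.log (mixture q μ z)|
      + |q x z * Real.log (q x z)| + q x z * Real.log 2) ν :=
    ((((hq.integrable_right hx).add hfx).add hlog).add hent.abs).add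
      ((hq.integrable_right hx).mul_const _)
  have hsmall : ∀ᶠ ε : ℝ in 𝓝[>] 0, 0 < ε ∧ ε ≤ 1 := by
    filter_upwards [Ioc_mem_nhdsGT (show (0 : ℝ) < 1 from one_pos)] with ε hε using hε
  have hb2 : ∀ ε : ℝ, 0 < ε → ε ≤ 1 → ∀ z,
      |q x z * (f z + Real.log (mixture q μ z + ε * q x z))| ≤
      q x z * |f z| + q x z * |Real.log (mixture q μ z)|
      + |q x z * Real.log (q x z)| + q x z * Real.log 2 := by
    intro ε h0 h1 z
    have hp := hq.pos x hx z
    have := abs_log_add_le (hq.mixture_pos hΩ hμ z) hp h0.le h1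
    rw [abs_mul, abs_mul, abs_of_pos hp, ← mul_add, ← mul_add, ← mul_add]
    refine mul_le_mul_of_nonneg_left ((abs_add_le _ _).trans ?_) hp.le
    linarith
  have hint2 : ∀ ε : ℝ, 0 < ε → ε ≤ 1 →
      Integrable (fun z => q x z * (f z + Real.log (mixture q μ z + ε * q x z))) ν :=
    fun ε h0 h1 => (((hfx.add hlog).add hent.abs).add
      ((hq.integrable_right hx).mul_const (Real.log 2))).mono'
      (Measurable.aestronglyMeasurable (by fun_prop)) (Eventually.of_forall (hb2 ε h0 h1))
  -- The logarithmic increment tends to `q(z|x)`, which is the source of the `+ 1` in the limit.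
  have key : Tendsto (fun ε : ℝ => ∫ z, (mixture q μ z *
        (Real.log (mixture q μ z + ε * q x z) - Real.log (mixture q μ z)) / ε +
        q x z * (f z + Real.log (mixture q μ z + ε * q x z))) ∂ν) (𝓝[>] 0)
      (𝓝 (∫ z, q x z * (f z + Real.log (mixture q μ z) + 1) ∂ν)) := by
    refine tendsto_integral_filter_of_dominated_convergence _ ?_ ?_ hbd ?_
    · exact Eventually.of_forall fun ε => Measurable.aestronglyMeasurable (by fun_prop)
    · filter_upwards [hsmall] with ε hε
      refine Eventually.of_forall fun z => ?_
      have h1 := mul_log_add_sub_log_mem_Icc (hq.mixture_pos hΩ hμ z) (hq.pos x hx z) hε.1.le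
      have h2 := hb2 ε hε.1 hε.2 z
      refine (norm_add_le _ _).trans ?_
      have h3 : ‖mixture q μ z * (Real.log (mixture q μ z + ε * q x z)
          - Real.log (mixture q μ z)) / ε‖ ≤ q x z := by
        rw [Real.norm_of_nonneg (div_nonneg h1.1 hε.1.le), div_le_iff₀ hε.1, mul_comm (q x z)]
        exact h1.2
      rw [← Real.norm_eq_abs] at h2
      linarith
    · refine Eventually.of_forall fun z => ?_
      have hp := hq.mixture_pos hΩ hμ z
      have h1 := tendsto_mul_log_add_sub_log_div (b := q x z) hp
      have h2 : Tendsto (fun ε : ℝ => q x z * (f z + Real.log (mixture q μ z + ε * q x z)))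
          (𝓝[>] 0) (𝓝 (q x z * (f z + Real.log (mixture q μ z)))) := by
        have : ContinuousAt (fun ε : ℝ => q x z * (f z + Real.log (mixture q μ z + ε * q x z)))
            0 := by
          refine continuousAt_const.mul (continuousAt_const.add (ContinuousAt.log ?_ ?_))
          · fun_prop
          · simpa using hp.ne'
        simpa using this.tendsto.mono_left nhdsWithin_le_nhds
      convert h1.add h2 using 2
      ring
  refine key.congr' ?_
  filter_upwards [hsmall] with ε hε
  obtain ⟨hi1, hF⟩ := hq.negELBO_add_dirac hΩ hμ hf hi hx hε.1
  rw [hF, integral_add (hi1.div_const _) (hint2 ε hε.1 hε.2), integral_div]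
  have := hε.1.ne'
  field_simp
  ring

end IsDensityFamily

/-! ### Gradient of the first variation and exchange of integrals -/

namespace IsDensityFamily

variable {d : ℕ} {Z : Type*} [MeasurableSpace Z] {ν : Measure Z} {Ω : Set (Vec d)}
  {q : Vec d → Z → ℝ} {μ : Measure (Vec d)}

lemma differentiableAt (hq : IsDensityFamily ν Ω q) (hΩ : IsOpen Ω) (z : Z) {x : Vec d}
    (hx : x ∈ Ω) : DifferentiableAt ℝ (fun y => q y z) x :=
  differentiableAt_of_contDiffOn hΩ (hq.contDiffOn z) hx

lemma measurable_gradient (hq : IsDensityFamily ν Ω q) (hΩ : IsOpen Ω) :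
    Measurable ((Ω ×ˢ (univ : Set Z)).indicator
      fun p : Vec d × Z => gradient (fun y => q y p.2) p.1) :=
  measurable_indicator_gradient hΩ hq.measurable fun z _ hx => hq.differentiableAt hΩ z hx

lemma measurable_gradient_right (hq : IsDensityFamily ν Ω q) (hΩ : IsOpen Ω) {x : Vec d}
    (hx : x ∈ Ω) : Measurable fun z => gradient (fun y => q y z) x := by
  have := (hq.measurable_gradient hΩ).comp (measurable_prodMk_left (x := x))
  convert this using 1
  ext1 z
  simp [hx]

/-- Differentiation of `x ↦ ∫ q(z|x) ψ(z) dν(z)` under the integral sign. -/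
lemma hasGradientAt_integral_mul (hq : IsDensityFamily ν Ω q) (hΩ : IsOpen Ω) {f ℓ ψ : Z → ℝ}
    (hmodel : IsIntegrableModel ν Ω q f ℓ) (hψ : Measurable ψ)
    (hψle : ∀ᵐ z ∂ν, |ψ z| ≤ 1 + |f z| + ℓ z) {x : Vec d} (hx : x ∈ Ω) :
    Integrable (fun z => ψ z • gradient (fun y => q y z) x) ν ∧
    HasGradientAt (fun y => ∫ z, q y z * ψ z ∂ν) (∫ z, ψ z • gradient (fun y => q y z) x ∂ν) x := by
  obtain ⟨U, hU, H, hH, hHi⟩ := hmodel.gradient_dominated x hx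
  have hbd : ∀ᵐ z ∂ν, ∀ y ∈ U ∩ Ω, ‖ψ z • gradient (fun y' => q y' z) y‖
      ≤ H z * (1 + |f z| + ℓ z) := by
    filter_upwards [hH, hψle] with z hz hz' y hy
    rw [norm_smul, mul_comm]
    exact mul_le_mul (hz y hy.1) hz' (abs_nonneg _) ((norm_nonneg _).trans (hz y hy.1))
  have hUΩ : U ∩ Ω ∈ 𝓝 x := inter_mem hU (hΩ.mem_nhds hx)
  have hgm : AEStronglyMeasurable (fun z => ψ z • gradient (fun y => q y z) x) ν :=
    (hψ.smul (hq.measurable_gradient_right hΩ hx)).aestronglyMeasurable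
  have hgi : Integrable (fun z => ψ z • gradient (fun y => q y z) x) ν :=
    hHi.mono' hgm (hbd.mono fun z hz => hz x (mem_of_mem_nhds hUΩ))
  refine ⟨hgi, ?_⟩
  have hF'm : AEStronglyMeasurable (fun z =>
      InnerProductSpace.toDual ℝ (Vec d) (ψ z • gradient (fun y => q y z) x)) ν :=
    (InnerProductSpace.toDual ℝ (Vec d)).continuous.comp_aestronglyMeasurable hgm
  have hF : Integrable (fun z => q x z * ψ z) ν := by
    refine ((hq.integrable_right hx).add (hmodel.expectation x hx)).mono'
      ((hq.measurable_right x).mul hψ).aestronglyMeasurable ?_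
    filter_upwards [hψle] with z hz
    rw [norm_mul, Real.norm_of_nonneg (hq.pos x hx z).le, Real.norm_eq_abs]
    calc _ ≤ q x z * (1 + |f z| + ℓ z) := mul_le_mul_of_nonneg_left hz (hq.pos x hx z).le
      _ = _ := by simp only [Pi.add_apply]; ring
  have hD := hasFDerivAt_integral_of_dominated_of_fderiv_le (𝕜 := ℝ) (μ := ν)
    (F := fun y z => q y z * ψ z)
    (F' := fun y z => InnerProductSpace.toDual ℝ (Vec d) (ψ z • gradient (fun y' => q y' z) y))
    hUΩ (Eventually.of_forall fun y => ((hq.measurable_right y).mul hψ).aestronglyMeasurable)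
    hF hF'm (by
      filter_upwards [hbd] with z hz y hy
      rw [LinearIsometryEquiv.norm_map]
      exact hz y hy) hHi (Eventually.of_forall fun z y hy => by
      simp only [map_smulₛₗ, toDual_gradient, conj_trivial]
      exact (hq.differentiableAt hΩ z hy.2).hasFDerivAt.mul_const (ψ z))
  have hF'i : Integrable (fun z =>
      InnerProductSpace.toDual ℝ (Vec d) (ψ z • gradient (fun y => q y z) x)) ν :=
    hgi.mono hF'm (Eventually.of_forall fun z => by rw [LinearIsometryEquiv.norm_map])
  have heq : InnerProductSpace.toDual ℝ (Vec d) (∫ z, ψ z • gradient (fun y => q y z) x ∂ν)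
      = ∫ z, InnerProductSpace.toDual ℝ (Vec d) (ψ z • gradient (fun y => q y z) x) ∂ν := by
    refine ContinuousLinearMap.ext fun v => ?_
    rw [ContinuousLinearMap.integral_apply hF'i]
    simp only [InnerProductSpace.toDual_apply_apply]
    rw [real_inner_comm, ← integral_inner hgi]
    simp only [real_inner_comm]
  rw [hasGradientAt_iff_hasFDerivAt, heq]
  exact hD

/-- On `Ω`, which carries `μ`, the gradient of `g` is a parametric integral of a jointly measurable
function. Measurability of the field is thus deduced from the model rather than assumed. -/
lemma aestronglyMeasurable_precond (hq : IsDensityFamily ν Ω q) (hΩ : IsOpen Ω) [SFinite ν]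
    (hμ : μ Ωᶜ = 0) {ψ : Z → ℝ} (hψ : Measurable ψ) {C : Vec d → Matrix (Fin d) (Fin d) ℝ}
    (hCm : ∀ i j, Measurable (fun x => C x i j)) {g : Vec d → ℝ}
    (hg : ∀ x ∈ Ω, gradient g x = ∫ z, ψ z • gradient (fun y => q y z) x ∂ν) :
    AEStronglyMeasurable (precond C (velocity g)) μ := by
  let V : Vec d → Vec d := fun x => ∫ z, ψ z • ((Ω ×ˢ (univ : Set Z)).indicator
      (fun p : Vec d × Z => gradient (fun y => q y p.2) p.1)) (x, z) ∂ν
  have hV : Measurable V := by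
    refine (StronglyMeasurable.integral_prod_right (f := fun x z => ψ z •
      ((Ω ×ˢ (univ : Set Z)).indicator
      (fun p : Vec d × Z => gradient (fun y => q y p.2) p.1)) (x, z)) ?_).measurable
    exact ((hψ.comp measurable_snd).smul (hq.measurable_gradient hΩ)).stronglyMeasurable
  have hW : Measurable fun x => Matrix.toEuclideanLin (C x) (-V x) := by
    refine (WithLp.measurable_toLp 2 (Fin d → ℝ)).comp (measurable_pi_iff.2 fun i => ?_)
      (g := WithLp.toLp 2) (f := fun x => WithLp.ofLp (Matrix.toEuclideanLin (C x) (-V x)))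
    have : (fun x => (Matrix.toEuclideanLin (C x) (-V x)).ofLp i)
        = fun x => ∑ j, C x i j * (-V x).ofLp j := by
      ext x
      simp [Matrix.toLpLin_apply, Matrix.mulVec, dotProduct]
    rw [this]
    refine Finset.measurable_sum _ fun j _ => (hCm i j).mul ?_
    exact (measurable_pi_apply j).comp ((WithLp.measurable_ofLp 2 (Fin d → ℝ)).comp hV.neg)
  refine hW.aestronglyMeasurable.congr ?_
  filter_upwards [ae_mem_of_measure_compl hμ] with x hx
  simp only [precond, velocity, hg x hx, V]
  simp [hx]

/-- Fubini's theorem for the pairing of `∇q(z|·)` with a field bounded in `L²(ρ_t)`. -/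
lemma integral_integral_inner_gradient [SigmaFinite ν] (hq : IsDensityFamily ν Ω q) {T : ℝ}
    {ρ : ℝ → Measure (Vec d)} {w : ℝ → Vec d → Vec d} {B : ℝ≥0} (F : IsBoundedFlow Ω T ρ w B)
    {f ℓ G ψ : Z → ℝ} (hcurve : IsIntegrableCurve ν q f ℓ G T ρ) (hψ : Measurable ψ)
    (hψle : ∀ᵐ z ∂ν, |ψ z| ≤ 1 + |f z| + ℓ z) {t : ℝ} (ht : t ∈ Icc 0 T)
    (hw : AEStronglyMeasurable (w t) (ρ t)) :
    Integrable (fun x => ∫ z, inner ℝ (gradient (fun y => q y z) x) (w t x) * ψ z ∂ν) (ρ t) ∧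
    ∫ z, (∫ x, inner ℝ (gradient (fun y => q y z) x) (w t x) ∂(ρ t)) * ψ z ∂ν =
      ∫ x, ∫ z, inner ℝ (gradient (fun y => q y z) x) (w t x) * ψ z ∂ν ∂(ρ t) := by
  have := F.prob t ht
  have hm : AEStronglyMeasurable (fun p : Vec d × Z =>
      inner ℝ (gradient (fun y => q y p.2) p.1) (w t p.1) * ψ p.2) ((ρ t).prod ν) := by
    have h1 : AEStronglyMeasurable (fun p : Vec d × Z => gradient (fun y => q y p.2) p.1)
        ((ρ t).prod ν) := by
      refine (hq.measurable_gradient F.isOpen).aestronglyMeasurable.congr ?_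
      filter_upwards [Measure.quasiMeasurePreserving_fst.ae
        (ae_mem_of_measure_compl (F.carried t ht))] with p hp
      simp [indicator, hp]
    exact (h1.inner hw.comp_fst).mul (hψ.comp measurable_snd).aestronglyMeasurable
  have hi : Integrable (fun p : Vec d × Z =>
      inner ℝ (gradient (fun y => q y p.2) p.1) (w t p.1) * ψ p.2) ((ρ t).prod ν) := by
    rw [integrable_prod_iff' hm]
    constructor
    · filter_upwards [hcurve.gradient_le] with z hz
      obtain ⟨M, hM⟩ := hq.exists_isBoundedC1 z
      exact (F.integrable_inner_gradient hM (hcurve.G_nonneg z) ht hw (hz t ht)).1.mul_const _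
    · refine (hcurve.integrable_G.const_mul (B : ℝ)).mono'
        hm.norm.prod_swap.integral_prod_right' ?_
      filter_upwards [hcurve.gradient_le, hψle] with z hz hz'
      obtain ⟨M, hM⟩ := hq.exists_isBoundedC1 z
      obtain ⟨h1, h2, h3⟩ := F.integrable_inner_gradient hM (hcurve.G_nonneg z) ht hw (hz t ht)
      rw [Real.norm_of_nonneg (integral_nonneg fun x => norm_nonneg _)]
      simp only [norm_mul, integral_mul_const]
      calc _ ≤ (G z * B) * (1 + |f z| + ℓ z) := by
            refine mul_le_mul ((integral_mono h1.norm h2 fun x => ?_).trans h3) hz'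
              (norm_nonneg _) (mul_nonneg (hcurve.G_nonneg z) B.2)
            exact abs_real_inner_le_norm _ _
        _ = _ := by ring
  refine ⟨hi.integral_prod_left, ?_⟩
  rw [integral_integral_swap (f := fun x z =>
    inner ℝ (gradient (fun y => q y z) x) (w t x) * ψ z) hi]
  simp only [integral_mul_const]

end IsDensityFamily

/-! ### Differentiation of the functional along the flow -/

namespace IsGradientFlow

variable {d : ℕ} {Z : Type*} [MeasurableSpace Z] {ν : Measure Z} {Ω : Set (Vec d)}
  {q : Vec d → Z → ℝ} {f : Z → ℝ} {C : Vec d → Matrix (Fin d) (Fin d) ℝ} {T : ℝ}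
  {ρ : ℝ → Measure (Vec d)} {g : ℝ → Vec d → ℝ} {B : ℝ≥0} {ℓ G : Z → ℝ}

lemma isBoundedFlow {L : Measure (Vec d) → ℝ} (hflow : IsGradientFlow L Ω C T ρ g)
    (hΩ : IsOpen Ω)
    (hB : ∀ t ∈ Icc 0 T, eLpNorm (precond C (velocity (g t))) 2 (ρ t) ≤ B) :
    IsBoundedFlow Ω T ρ (fun t => precond C (velocity (g t))) B :=
  ⟨hΩ, hflow.isProbabilityMeasure, hflow.carried, hflow.continuityEq, hB⟩

end IsGradientFlow

namespace IsBoundedFlow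

variable {d : ℕ} {Z : Type*} [MeasurableSpace Z] {ν : Measure Z} {Ω : Set (Vec d)}
  {q : Vec d → Z → ℝ} {f : Z → ℝ} {T : ℝ} {ρ : ℝ → Measure (Vec d)} {w : ℝ → Vec d → Vec d}
  {B : ℝ≥0} {ℓ G : Z → ℝ}

/-- Integrability propagates from time `0`: the Lipschitz estimate applied to `q(z|·)` gives
`q_{ρ_t} ≤ q_{ρ_0} + B t G`. -/
lemma integrable_mixture_mul (F : IsBoundedFlow Ω T ρ w B) (hq : IsDensityFamily ν Ω q)
    (hf : Measurable f) (hcurve : IsIntegrableCurve ν q f ℓ G T ρ) {t : ℝ} (ht : t ∈ Icc 0 T) :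
    Integrable (fun z => mixture q (ρ t) z * (f z + Real.log (mixture q (ρ t) z))) ν := by
  have := F.prob t ht
  have h0 : (0 : ℝ) ∈ Icc 0 T := ⟨le_rfl, ht.1.trans ht.2⟩
  have hm := hq.measurable_mixture (ρ t)
  refine (hcurve.initial.add (hcurve.integrable_G.const_mul (B * t))).mono'
    (Measurable.aestronglyMeasurable (by fun_prop)) ?_
  filter_upwards [hcurve.log_le, hcurve.gradient_le] with z hz hz'
  obtain ⟨M, hM⟩ := hq.exists_isBoundedC1 z
  have hG := hcurve.G_nonneg z
  have h1 : |mixture q (ρ t) z - mixture q (ρ 0) z| ≤ G z * B * |t - 0| :=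
    F.abs_integral_sub_le hM hG hz' h0 ht
  rw [sub_zero, abs_of_nonneg ht.1] at h1
  have hpos := hq.mixture_pos F.isOpen (F.carried t ht) z
  have h2 : |f z + Real.log (mixture q (ρ t) z)| ≤ |f z| + ℓ z :=
    (abs_add_le _ _).trans (by gcongr; exact hz t ht)
  have h3 : 0 ≤ |f z| + ℓ z := (abs_nonneg _).trans h2
  have h4 : 0 ≤ B * t * G z := mul_nonneg (mul_nonneg B.2 ht.1) hG
  rw [norm_mul, Real.norm_of_nonneg hpos.le, Real.norm_eq_abs]
  calc _ ≤ (mixture q (ρ 0) z + B * t * G z) * (|f z| + ℓ z) :=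
        mul_le_mul (by linarith [le_abs_self (mixture q (ρ t) z - mixture q (ρ 0) z)]) h2
          (abs_nonneg _) (by linarith [le_abs_self (mixture q (ρ t) z - mixture q (ρ 0) z)])
    _ ≤ _ := by
        simp only [Pi.add_apply]
        linarith

/-- After the exchange of integrals, each `z` contributes `r (f + log r)`, whose time derivative is
`r' (f + log r + 1)` with `r'` from the extended continuity equation. Cauchy–Schwarz gives `|r'| ≤ G
B`, hence an integrable majorant. -/
lemma hasDerivWithinAt_negELBO [SigmaFinite ν] (F : IsBoundedFlow Ω T ρ w B)
    (hq : IsDensityFamily ν Ω q) (hf : Measurable f)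
    (hcurve : IsIntegrableCurve ν q f ℓ G T ρ)
    (hw : ∀ t ∈ Icc 0 T, AEStronglyMeasurable (w t) (ρ t)) {t : ℝ} (ht : t ∈ Icc 0 T) :
    HasDerivWithinAt (fun s => negELBO ν q f (ρ s))
      (∫ z, (∫ x, inner ℝ (gradient (fun y => q y z) x) (w t x) ∂(ρ t)) *
        (f z + Real.log (mixture q (ρ t) z) + 1) ∂ν) (Icc 0 T) t := by
  have hL : ∀ s ∈ Icc 0 T, negELBO ν q f (ρ s) =
      ∫ z, mixture q (ρ s) z * (f z + Real.log (mixture q (ρ s) z)) ∂ν := fun s hs => by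
    have := F.prob s hs
    have hm := hq.measurable_mixture (ρ s)
    exact hq.integral_integral F.isOpen (F.carried s hs) (by fun_prop)
      (F.integrable_mixture_mul hq hf hcurve hs)
  refine HasDerivWithinAt.congr_of_mem ?_ hL ht
  refine hasDerivWithinAt_integral_of_dominated (convex_Icc 0 T) ht
    (F' := fun s z => (∫ x, inner ℝ (gradient (fun y => q y z) x) (w s x) ∂(ρ s)) *
        (f z + Real.log (mixture q (ρ s) z) + 1))
    (fun s hs => F.integrable_mixture_mul hq hf hcurve hs)
    (hcurve.integrable_G.const_mul (B : ℝ)) ?_ ?_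
  · refine Eventually.of_forall fun z s hs => ?_
    have := F.prob s hs
    obtain ⟨M, hM⟩ := hq.exists_isBoundedC1 z
    have hpos := (hq.mixture_pos F.isOpen (F.carried s hs) z).ne'
    have h1 : HasDerivWithinAt (fun r => mixture q (ρ r) z)
        (∫ x, inner ℝ (gradient (fun y => q y z) x) (w s x) ∂(ρ s)) (Icc 0 T) s :=
      F.hasDerivWithinAt_integral hM hs (hw s hs)
    refine (h1.mul ((h1.log hpos).const_add (f z))).congr_deriv ?_
    rw [mul_div_cancel₀ _ hpos]
    ring
  · filter_upwards [hcurve.log_le, hcurve.gradient_le] with z hz hz' s hs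
    obtain ⟨M, hM⟩ := hq.exists_isBoundedC1 z
    have h1 := F.abs_integral_inner_gradient_le hM (hcurve.G_nonneg z) hs (hz' s hs)
    have h2 : |f z + Real.log (mixture q (ρ s) z) + 1| ≤ 1 + |f z| + ℓ z := by
      refine (abs_add_le _ _).trans ?_
      rw [abs_one]
      linarith [abs_add_le (f z) (Real.log (mixture q (ρ s) z)), hz s hs]
    rw [abs_mul]
    calc _ ≤ (G z * B) * (1 + |f z| + ℓ z) :=
          mul_le_mul h1 h2 (abs_nonneg _) (mul_nonneg (hcurve.G_nonneg z) B.2)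
      _ = _ := by ring

end IsBoundedFlow

lemma inner_precond_nonneg {d : ℕ} {C : Vec d → Matrix (Fin d) (Fin d) ℝ} {x : Vec d}
    (hC : (C x).PosDef) (v : Vec d → Vec d) : 0 ≤ inner ℝ (v x) (precond C v x) := by
  have := hC.posSemidef.dotProduct_mulVec_nonneg (v x).ofLp
  simp only [precond, Matrix.toLpLin_apply, EuclideanSpace.inner_eq_star_dotProduct]
  simpa [dotProduct_comm] using this

end VarFlow

/-! ### The dissipation identity -/

open VarFlow in
theorem proposition1 {d : ℕ} {Z : Type*} [MeasurableSpace Z] (ν : Measure Z) [SigmaFinite ν]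
    (Ω : Set (Vec d)) (hΩ : IsOpen Ω)
    (q : Vec d → Z → ℝ) (hq : IsDensityFamily ν Ω q)
    (f : Z → ℝ) (hf : Measurable f)
    (C : Vec d → Matrix (Fin d) (Fin d) ℝ) (hCm : ∀ i j, Measurable (fun x => C x i j))
    (hC : ∀ x ∈ Ω, (C x).PosDef)
    (T : ℝ) (hT : 0 < T) (ρ : ℝ → Measure (Vec d)) (g : ℝ → Vec d → ℝ)
    (hflow : IsGradientFlow (negELBO ν q f) Ω C T ρ g)
    (B : ℝ≥0) (hB : ∀ t ∈ Icc 0 T, eLpNorm (precond C (velocity (g t))) 2 (ρ t) ≤ B)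
    (ℓ G : Z → ℝ) (hmodel : IsIntegrableModel ν Ω q f ℓ)
    (hcurve : IsIntegrableCurve ν q f ℓ G T ρ) :
    (∀ t ∈ Icc 0 T,
      Integrable (fun p : Vec d × Z => q p.1 p.2 * (f p.2 + Real.log (mixture q (ρ t) p.2)))
        ((ρ t).prod ν) ∧
      (∀ x ∈ Ω, DifferentiableAt ℝ (g t) x) ∧
      Integrable (fun x => inner ℝ (velocity (g t) x) (precond C (velocity (g t)) x)) (ρ t) ∧
      HasDerivWithinAt (fun s => negELBO ν q f (ρ s))
        (-∫ x, inner ℝ (velocity (g t) x) (precond C (velocity (g t)) x) ∂(ρ t)) (Icc 0 T) t ∧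
      0 ≤ ∫ x, inner ℝ (velocity (g t) x) (precond C (velocity (g t)) x) ∂(ρ t)) ∧
    AntitoneOn (fun t => negELBO ν q f (ρ t)) (Icc 0 T) := by
  have F := hflow.isBoundedFlow hΩ hB
  let ψ : ℝ → Z → ℝ := fun t z => f z + Real.log (mixture q (ρ t) z) + 1
  have hψ : ∀ t ∈ Icc 0 T, Measurable (ψ t) := fun t ht => by
    have := F.prob t ht
    have hm := hq.measurable_mixture (ρ t)
    fun_prop
  have hψle : ∀ t ∈ Icc 0 T, ∀ᵐ z ∂ν, |ψ t z| ≤ 1 + |f z| + ℓ z := fun t ht => by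
    filter_upwards [hcurve.log_le] with z hz
    refine (abs_add_le _ _).trans ?_
    rw [abs_one]
    linarith [abs_add_le (f z) (Real.log (mixture q (ρ t) z)), hz t ht]
  have hg : ∀ t ∈ Icc 0 T, ∀ x ∈ Ω, g t x = ∫ z, q x z * ψ t z ∂ν := fun t ht x hx => by
    have := F.prob t ht
    have hm := hq.measurable_mixture (ρ t)
    have hqm := hq.measurable_right x
    have hpos := hq.pos x hx
    refine hq.eq_of_isFirstVariation hΩ (F.carried t ht) hf
      (F.integrable_mixture_mul hq hf hcurve ht) hx ?_ ?_ (hmodel.entropy x hx)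
      (hflow.firstVariation t ht) <;>
    · refine (hmodel.expectation x hx).mono' (Measurable.aestronglyMeasurable (by fun_prop)) ?_
      filter_upwards [hcurve.log_le] with z hz
      rw [norm_mul, Real.norm_of_nonneg (hpos z).le, norm_abs_eq_norm, Real.norm_eq_abs]
      refine mul_le_mul_of_nonneg_left ?_ (hpos z).le
      linarith [abs_nonneg (f z), hz t ht, abs_nonneg (Real.log (mixture q (ρ t) z))]
  have hgrad : ∀ t ∈ Icc 0 T, ∀ x ∈ Ω,
      Integrable (fun z => ψ t z • gradient (fun y => q y z) x) ν ∧
      HasGradientAt (g t) (∫ z, ψ t z • gradient (fun y => q y z) x ∂ν) x := fun t ht x hx => by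
    obtain ⟨h1, h2⟩ := hq.hasGradientAt_integral_mul hΩ hmodel (hψ t ht) (hψle t ht) hx
    refine ⟨h1, h2.congr_of_eventuallyEq ?_⟩
    filter_upwards [hΩ.mem_nhds hx] with y hy using hg t ht y hy
  have hw : ∀ t ∈ Icc 0 T, AEStronglyMeasurable (precond C (velocity (g t))) (ρ t) :=
    fun t ht => hq.aestronglyMeasurable_precond hΩ (F.carried t ht) (hψ t ht) hCm
      fun x hx => (hgrad t ht x hx).2.gradient
  have main : ∀ t ∈ Icc 0 T,
      Integrable (fun x => inner ℝ (velocity (g t) x) (precond C (velocity (g t)) x)) (ρ t) ∧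
      HasDerivWithinAt (fun s => negELBO ν q f (ρ s))
        (-∫ x, inner ℝ (velocity (g t) x) (precond C (velocity (g t)) x) ∂(ρ t)) (Icc 0 T) t ∧
      0 ≤ ∫ x, inner ℝ (velocity (g t) x) (precond C (velocity (g t)) x) ∂(ρ t) := by
    intro t ht
    obtain ⟨hi, hF⟩ := hq.integral_integral_inner_gradient F hcurve (hψ t ht) (hψle t ht) ht
      (hw t ht)
    -- Moving the `z`-integral inside the inner product produces `∇(g t) = -v_t`, whence the minus
    -- sign.
    have hae : (fun x => ∫ z, inner ℝ (gradient (fun y => q y z) x)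
        (precond C (velocity (g t)) x) * ψ t z ∂ν) =ᵐ[ρ t]
        fun x => -inner ℝ (velocity (g t) x) (precond C (velocity (g t)) x) := by
      filter_upwards [ae_mem_of_measure_compl (F.carried t ht)] with x hx
      obtain ⟨h1, h2⟩ := hgrad t ht x hx
      generalize precond C (velocity (g t)) x = u
      rw [velocity, h2.gradient, inner_neg_left, neg_neg, real_inner_comm, ← integral_inner h1]
      refine integral_congr_ae (Eventually.of_forall fun z => ?_)
      simp only [inner_smul_right, real_inner_comm, mul_comm]
    -- Integrability of the dissipation comes from Fubini. The `L²` bound on `C v_t` alone would not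
    -- give it, since it does not control `v_t`.
    refine ⟨(hi.congr hae).neg.congr (Eventually.of_forall fun x => neg_neg _), ?_, ?_⟩
    · rw [← integral_neg, ← integral_congr_ae hae, ← hF]
      exact F.hasDerivWithinAt_negELBO hq hf hcurve hw ht
    · refine integral_nonneg_of_ae ?_
      filter_upwards [ae_mem_of_measure_compl (F.carried t ht)] with x hx
      exact inner_precond_nonneg (hC x hx) _
  refine ⟨fun t ht => ⟨?_, fun x hx => (hgrad t ht x hx).2.differentiableAt, main t ht⟩, ?_⟩
  · have := F.prob t ht
    have hm := hq.measurable_mixture (ρ t)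
    exact hq.integrable_prod hΩ (F.carried t ht) (ψ := fun z => f z +
      Real.log (mixture q (ρ t) z)) (by fun_prop) (F.integrable_mixture_mul hq hf hcurve ht)
  · refine antitoneOn_of_hasDerivWithinAt_nonpos (convex_Icc 0 T)
      (fun t ht => (main t ht).2.1.continuousWithinAt)
      (fun t ht => (main t (interior_subset ht)).2.1.mono interior_subset)
      fun t ht => neg_nonpos.2 (main t (interior_subset ht)).2.2
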